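/- Let $n\ge 1$ be an integer and $d>0$ a real number. Let $\mathcal C$ be a dyadic grid of half-open cubes in $\mathbb R^n$: for some $L>0$ and every $k\in\mathbb Z$, the cubes of $\mathcal C$ of side length $2^kL$ are the translates, by vectors of the lattice $2^kL\,\mathbb Z^n$, of one cube $\prod_i[a^{(k)}_i,a^{(k)}_i+2^kL)$, where $a^{(k+1)}-a^{(k)}\in 2^kL\,\mathbb Z^n$ (so that the cubes are nested). For $R\in\mathcal C$ let $\ell(R)$ be its side length, $R^{(j)}$ its $j$-fold dyadic ancestor, so that $R^{(0)}=R$ and $R^{(1)}$ is its parent, $\mathrm{Box}_R=R\times[0,\ell(R)]\subset\mathbb R^{n+1}$, $W(R)=R\times[\ell(R)/2,\ell(R)]$, and $x_{W(R)}$ the centre of $W(R)$. Let $\sigma$ be a locally finite Borel measure on $\mathbb R^n$, let $\eta_R\ge 0$ $(R\in\mathcal C)$ be constants, and suppose that the measure $\eta=\sum_{R\in\mathcal C}\eta_R\,\delta_{x_{W(R)}}$ is finite on every bounded rectangle of $\mathbb R^{n}\times\mathbb R$. For measurable $\varphi\ge 0$ put $$\mathsf Q_\sigma(\varphi,R)=\sum_{j\ge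 0}\frac1{[2^j\ell(R)]^{d+1}}\int_{R^{(j)}}\varphi\,d\sigma,\qquad R\in\mathcal C,$$ and let $\mathscr Q\in[0,\infty]$ be the best constant in the two-weight inequality with holes $$\sum_{R\in\mathcal C}\mathsf Q_\sigma(\varphi\mathbf 1_{\mathbb R^n\setminus R},R)^2\,\eta_R\le\mathscr Q^2\,\|\varphi\|_{L^2(\sigma)}^2\qquad\text{for all } 0\le\varphi\in L^2(\sigma).\tag{QQ}$$ Then (QQ) holds with a finite constant if and only if the following three constants are all finite (with the convention $0/0=0$ for $R_0$ with $\sigma(R_0)=0$, respectively $\eta(\mathrm{Box}_{R_0})=0$): $$\mathscr Q_1=\sup_{R\in\mathcal C}\frac{[\sigma(R^{(1)}\setminus R)\,\eta(\mathrm{Box}_R)]^{1/2}}{\ell(R)^{d+1}},$$ $$\mathscr Q_2=\sup_{R_0\in\mathcal C}\sigma(R_0)^{-1/2}\Bigl\|\sum_{R\in\mathcal C:\,R^{(1)}\subset R_0}\frac{\sigma(R^{(1)}\setminus R)}{\ell(R)^{d+1}}\mathbf 1_{\mathrm{Box}_R}\Bigr\|_{L^2(\eta)},$$ $$\mathscr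 Q_3=\sup_{R_0\in\mathcal C}\eta(\mathrm{Box}_{R_0})^{-1/2}\Bigl\|\sum_{R\in\mathcal C:\,R^{(1)}\subset R_0}\frac{\eta(\mathrm{Box}_R)}{\ell(R)^{d+1}}\mathbf 1_{R^{(1)}\setminus R}\Bigr\|_{L^2(\sigma)}.$$ Moreover $\mathscr Q\simeq\mathscr Q_1+\mathscr Q_2+\mathscr Q_3$: there is a constant $c\in(0,\infty)$ depending only on $n$ and $d$ such that $\mathscr Q\le c(\mathscr Q_1+\mathscr Q_2+\mathscr Q_3)$ and $\mathscr Q_1+\mathscr Q_2+\mathscr Q_3\le c\,\mathscr Q$. -/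

import Mathlib

open MeasureTheory
open scoped ENNReal NNReal

noncomputable section

/-- A dyadic grid of half-open cubes in `ℝⁿ`. At level `k : ℤ` the cubes have side length
`scale * 2 ^ k` and tile `ℝⁿ` as translates of one another, one of them having lower corner
`origin k`; the grids of consecutive levels are nested. -/
structure DyadicGrid (n : ℕ) where
  scale : ℝ
  scale_pos : 0 < scale
  origin : ℤ → Fin n → ℝ
  nested : ∀ (k : ℤ) (i : Fin n), ∃ z : ℤ,
    origin (k + 1) i - origin k i = z * (scale * 2 ^ k)

namespace DyadicGrid

variable {n : ℕ}

/-- The cubes of a dyadic grid are indexed by their level and their position at that level. -/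
abbrev Index (n : ℕ) : Type := ℤ × (Fin n → ℤ)

variable (C : DyadicGrid n)

/-- Side length `ℓ(R)`. -/
def side (R : Index n) : ℝ := C.scale * 2 ^ R.1

/-- Lower corner of `R`. -/
def corner (R : Index n) : Fin n → ℝ := fun i => C.origin R.1 i + C.side R * R.2 i

/-- The cube `R` as a subset of `ℝⁿ`. -/
def cube (R : Index n) : Set (Fin n → ℝ) :=
  {x | ∀ i, C.corner R i ≤ x i ∧ x i < C.corner R i + C.side R}

/-- The centre of `R`. -/
def center (R : Index n) : Fin n → ℝ := fun i => C.corner R i + C.side R / 2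

/-- The dyadic parent `R⁽¹⁾`: the cube of the next level that contains the lower corner of `R`
(and hence contains `R`, see `cube_subset_parent`). -/
def parent (R : Index n) : Index n :=
  (R.1 + 1, fun i => ⌊(C.corner R i - C.origin (R.1 + 1) i) / (C.scale * 2 ^ (R.1 + 1))⌋)

/-- The `j`-fold dyadic ancestor `R⁽ʲ⁾`. -/
def ancestor (j : ℕ) (R : Index n) : Index n := C.parent^[j] R

/-- `Box_R = R × [0, ℓ(R)]`. -/
def box (R : Index n) : Set ((Fin n → ℝ) × ℝ) := C.cube R ×ˢ Set.Icc 0 (C.side R)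

/-- The centre of the Whitney box `W(R) = R × [ℓ(R)/2, ℓ(R)]`. -/
def whitneyCenter (R : Index n) : (Fin n → ℝ) × ℝ := (C.center R, 3 / 4 * C.side R)

/-- The measure `∑_R η_R δ_{x_{W(R)}}` on `ℝⁿ × ℝ`. -/
def etaMeasure (η : Index n → ℝ≥0) : Measure ((Fin n → ℝ) × ℝ) :=
  Measure.sum fun R => η R • Measure.dirac (C.whitneyCenter R)

/-- `ℓ(R)^(d+1)` as an extended non-negative number. -/
def sidePow (d : ℝ) (R : Index n) : ℝ≥0∞ := ENNReal.ofReal (C.side R ^ (d + 1))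

/-- The dyadic Poisson-type operator
`Q_σ(φ, R) = ∑_{j ≥ 0} [2^j ℓ(R)]^{-(d+1)} ∫_{R⁽ʲ⁾} φ dσ`, for `φ ≥ 0`. -/
def poissonQ (d : ℝ) (σ : Measure (Fin n → ℝ)) (φ : (Fin n → ℝ) → ℝ≥0∞) (R : Index n) : ℝ≥0∞ :=
  ∑' j : ℕ, (∫⁻ x in C.cube (C.ancestor j R), φ x ∂σ) /
    ENNReal.ofReal ((2 ^ j * C.side R) ^ (d + 1))

/-- The two weight inequality with holes, with constant `K`:
`∑_R Q_σ(φ 1_{Rᶜ}, R)² η_R ≤ K² ‖φ‖²` for all non-negative `φ ∈ L²(σ)`. -/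
def HolesInequality (d : ℝ) (σ : Measure (Fin n → ℝ)) (η : Index n → ℝ≥0) (K : ℝ≥0∞) : Prop :=
  ∀ φ : (Fin n → ℝ) → ℝ≥0∞, MemLp φ 2 σ →
    ∑' R : Index n, C.poissonQ d σ ((C.cube R)ᶜ.indicator φ) R ^ 2 * (η R : ℝ≥0∞) ≤
      K ^ 2 * eLpNorm φ 2 σ ^ 2

/-- The best constant in the two weight inequality with holes (`∞` if there is none). -/
def bestConst (d : ℝ) (σ : Measure (Fin n → ℝ)) (η : Index n → ℝ≥0) : ℝ≥0∞ :=
  sInf {K | C.HolesInequality d σ η K}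

/-- `sup_R [σ(R⁽¹⁾ \ R) η(Box_R)]^{1/2} / ℓ(R)^{d+1}`. -/
def constQ₁ (d : ℝ) (σ : Measure (Fin n → ℝ)) (η : Index n → ℝ≥0) : ℝ≥0∞ :=
  ⨆ R : Index n,
    (σ (C.cube (C.parent R) \ C.cube R) * C.etaMeasure η (C.box R)) ^ (1 / 2 : ℝ) / C.sidePow d R

/-- `sup_{R₀} σ(R₀)^{-1/2} ‖∑_{R⁽¹⁾ ⊆ R₀} σ(R⁽¹⁾ \ R) ℓ(R)^{-(d+1)} 1_{Box_R}‖_{L²(η)}`.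
The norm vanishes when `σ(R₀) = 0`, and such `R₀` contribute `0`. -/
def constQ₂ (d : ℝ) (σ : Measure (Fin n → ℝ)) (η : Index n → ℝ≥0) : ℝ≥0∞ :=
  ⨆ R₀ : Index n,
    eLpNorm (fun p => ∑' R : {R : Index n // C.cube (C.parent R) ⊆ C.cube R₀},
        (C.box R).indicator
          (fun _ => σ (C.cube (C.parent R) \ C.cube R) / C.sidePow d R) p)
      2 (C.etaMeasure η) / σ (C.cube R₀) ^ (1 / 2 : ℝ)

/-- `sup_{R₀} η(Box_{R₀})^{-1/2} ‖∑_{R⁽¹⁾ ⊆ R₀} η(Box_R) ℓ(R)^{-(d+1)} 1_{R⁽¹⁾ \ R}‖_{L²(σ)}`.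
The norm vanishes when `η(Box_{R₀}) = 0`, and such `R₀` contribute `0`. -/
def constQ₃ (d : ℝ) (σ : Measure (Fin n → ℝ)) (η : Index n → ℝ≥0) : ℝ≥0∞ :=
  ⨆ R₀ : Index n,
    eLpNorm (fun x => ∑' R : {R : Index n // C.cube (C.parent R) ⊆ C.cube R₀},
        (C.cube (C.parent R) \ C.cube R).indicator
          (fun _ => C.etaMeasure η (C.box R) / C.sidePow d R) x)
      2 σ / C.etaMeasure η (C.box R₀) ^ (1 / 2 : ℝ)

theorem side_pos (R : Index n) : 0 < C.side R :=
  mul_pos C.scale_pos (by positivity)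

theorem side_parent (R : Index n) : C.side (C.parent R) = 2 * C.side R := by
  simp only [side, parent]
  rw [zpow_add₀ two_ne_zero, zpow_one]
  ring

/-- Every cube of the grid is contained in its parent. -/
theorem cube_subset_parent (R : Index n) : C.cube R ⊆ C.cube (C.parent R) := by
  intro x hx i
  obtain ⟨h1, h2⟩ := hx i
  obtain ⟨z, hz⟩ := C.nested R.1 i
  have hs := C.side_pos R
  have hp := C.side_parent R
  have hq : C.scale * 2 ^ (R.1 + 1) = 2 * C.side R := hp
  have hsd : C.scale * 2 ^ R.1 = C.side R := rfl
  have hc : C.corner R i - C.origin (R.1 + 1) i = ((R.2 i - z : ℤ) : ℝ) * C.side R := by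
    rw [hsd] at hz
    simp only [corner]
    push_cast
    linarith
  set m : ℤ := R.2 i - z with hm
  set f : ℤ := ⌊(C.corner R i - C.origin (R.1 + 1) i) / (C.scale * 2 ^ (R.1 + 1))⌋ with hf
  have hdiv : (C.corner R i - C.origin (R.1 + 1) i) / (C.scale * 2 ^ (R.1 + 1)) = (m : ℝ) / 2 := by
    rw [hc, hq]
    field_simp
  have hf1 : (f : ℝ) ≤ (m : ℝ) / 2 := hdiv ▸ Int.floor_le _
  have hf2 : (m : ℝ) / 2 < f + 1 := hdiv ▸ Int.lt_floor_add_one _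
  have hlt : m < 2 * f + 2 := by
    have : (m : ℝ) < ((2 * f + 2 : ℤ) : ℝ) := by
      push_cast
      linarith
    exact_mod_cast this
  have hle : (m : ℝ) + 1 ≤ 2 * f + 2 := by
    exact_mod_cast (by omega : m + 1 ≤ 2 * f + 2)
  have hcp : C.corner (C.parent R) i = C.origin (R.1 + 1) i + 2 * C.side R * f := by
    simp only [corner, hp]
    rfl
  rw [hcp, hp]
  constructor
  · nlinarith
  · nlinarith

end DyadicGrid

end

/-! At the Whitney centre $x_{W(R)}$, the quantity $\mathsf Q_\sigma(\varphi\mathbf 1_{\mathbb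
R^n\setminus R},R)$ is comparable with the positive operator `holesOp`,
$T\varphi=\sum_R\ell(R)^{-(d+1)}\bigl(\int_{R^{(1)}\setminus R}\varphi\,d\sigma\bigr)\mathbf
1_{\mathrm{Box}_R}$. Indeed $R^{(j)}\setminus R$ splits into the shells $R^{(i+1)}\setminus
R^{(i)}$, $i<j$, and the powers of the side lengths sum geometrically (`poissonQ_le_holesOp`,
`holesOp_le_poissonQ`). So (QQ) is a bound for $T:L^2(\sigma)\to L^2(\eta)$.

Each hole $R^{(1)}\setminus R$ is the union of the siblings $S$ of $R$. Pairing with $g$ therefore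
gives $\sum_{(R,S)}\ell(R)^{-(d+1)}\int_S\varphi\,d\sigma\int_{\mathrm{Box}_R}g\,d\eta$, a form over
pairs of siblings in one tree that carries two nested families: the cubes with $\sigma$ and the
boxes with $\eta$.

`bilinear_sum_le` bounds such a form by parallel stopping vertices. On each side the stopping
vertices are those where the average more than doubles, and averages are replaced by those over the
stopping ancestors. If one member of a pair does not stop, its stopping ancestor lies above the
common parent, so the two stopping ancestors are nested; a testing condition ($\mathscr Q_2$ or
$\mathscr Q_3$, according to which ancestor is the higher) then controls the sum below the higher
one. If both members stop, the ancestors are disjoint siblings, no testing condition applies, and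
$\mathscr Q_1$ is used term by term. The Carleson embedding `sum_sq_treeAverage_le` sums the pieces.

Conversely, testing $T$ on indicators gives $\mathscr Q_1$ and $\mathscr Q_2$, and testing its
adjoint on $\mathbf 1_{\mathrm{Box}_{R_0}}$ gives $\mathscr Q_3$. -/

noncomputable section

/-! ### Cauchy–Schwarz and square roots in `ℝ≥0∞`. -/

section CauchySchwarz

theorem ENNReal.sqrt_sq (x : ℝ≥0∞) : (x ^ 2) ^ (1 / 2 : ℝ) = x := by
  rw [← ENNReal.rpow_natCast, ← ENNReal.rpow_mul]
  norm_num

theorem ENNReal.sq_sqrt (x : ℝ≥0∞) : (x ^ (1 / 2 : ℝ)) ^ 2 = x := by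
  rw [← ENNReal.rpow_natCast, ← ENNReal.rpow_mul]
  norm_num

theorem ENNReal.mul_sqrt (x y : ℝ≥0∞) :
    (x * y) ^ (1 / 2 : ℝ) = x ^ (1 / 2 : ℝ) * y ^ (1 / 2 : ℝ) :=
  ENNReal.mul_rpow_of_nonneg _ _ (by norm_num)

theorem ENNReal.sqrt_mono {x y : ℝ≥0∞} (h : x ≤ y) : x ^ (1 / 2 : ℝ) ≤ y ^ (1 / 2 : ℝ) :=
  ENNReal.rpow_le_rpow h (by norm_num)

theorem ENNReal.mul_self_sqrt (x : ℝ≥0∞) : x ^ (1 / 2 : ℝ) * x ^ (1 / 2 : ℝ) = x := by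
  rw [← sq, ENNReal.sq_sqrt]

theorem ENNReal.sum_mul_le_sqrt {ι : Type*} (s : Finset ι) (f g : ι → ℝ≥0∞) :
    ∑ i ∈ s, f i * g i ≤ (∑ i ∈ s, f i ^ 2) ^ (1 / 2 : ℝ) * (∑ i ∈ s, g i ^ 2) ^ (1 / 2 : ℝ) := by
  have h := ENNReal.inner_le_Lp_mul_Lq s f g (p := 2) (q := 2) Real.HolderConjugate.two_two
  simp only [ENNReal.rpow_two] at h
  exact h

theorem lintegral_mul_le_sqrt {X : Type*} [MeasurableSpace X] (μ : Measure X) {f g : X → ℝ≥0∞}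
    (hf : AEMeasurable f μ) (hg : AEMeasurable g μ) :
    ∫⁻ x, f x * g x ∂μ ≤
      (∫⁻ x, f x ^ 2 ∂μ) ^ (1 / 2 : ℝ) * (∫⁻ x, g x ^ 2 ∂μ) ^ (1 / 2 : ℝ) := by
  have h := ENNReal.lintegral_mul_le_Lp_mul_Lq μ Real.HolderConjugate.two_two hf hg
  simp only [ENNReal.rpow_two] at h
  exact h

/-- The absorption argument: `X ≤ a √X` with `X` finite gives `√X ≤ a`. -/
theorem ENNReal.sqrt_le_of_le_mul_sqrt {X a : ℝ≥0∞} (hX : X ≠ ∞) (h : X ≤ a * X ^ (1 / 2 : ℝ)) :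
    X ^ (1 / 2 : ℝ) ≤ a := by
  rcases eq_or_ne X 0 with rfl | h0
  · simp
  have h1 : X ^ (1 / 2 : ℝ) ≠ 0 := by simp [h0]
  have h2 : X ^ (1 / 2 : ℝ) ≠ ∞ := by simp [hX]
  have h3 : X ^ (1 / 2 : ℝ) * X ^ (1 / 2 : ℝ) ≤ a * X ^ (1 / 2 : ℝ) := by
    rwa [ENNReal.mul_self_sqrt]
  exact (ENNReal.mul_le_mul_iff_left h1 h2).1 h3

end CauchySchwarz

/-! ### Stopping vertices in a tree and the Carleson embedding theorem. -/

section Tree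

variable {I : Type*}

/-- `F` assigns to each vertex `Q` of a tree, up to level `N`, its stopping ancestor with respect
to the doubling of `w`. -/
structure IsStoppingMap (par : I → I) (lev : I → ℤ) (w : I → ℝ≥0∞) (N : ℤ) (F : I → I) :
    Prop where
  le_two_mul : ∀ Q, w Q ≤ 2 * w (F Q)
  self_or : ∀ Q, F Q = Q ∨ (lev Q < N ∧ F Q = F (par Q))
  jump : ∀ Q, lev Q < N → F Q = Q → 2 * w (F (par Q)) ≤ w Q

open Classical in
/-- The stopping ancestor of a vertex that lies `k` steps below the top. -/
def stopAux (par : I → I) (w : I → ℝ≥0∞) : ℕ → I → I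
  | 0, Q => Q
  | k + 1, Q => if 2 * w (stopAux par w k (par Q)) < w Q then Q else stopAux par w k (par Q)

theorem le_lev_stopAux {par : I → I} {lev : I → ℤ} (hlev : ∀ Q, lev (par Q) = lev Q + 1)
    (w : I → ℝ≥0∞) (k : ℕ) (Q : I) : lev Q ≤ lev (stopAux par w k Q) := by
  induction k generalizing Q with
  | zero => exact le_rfl
  | succ k ih =>
    rw [stopAux]
    split_ifs
    · exact le_rfl
    · have := ih (par Q)
      rw [hlev] at this
      omega

theorem exists_isStoppingMap {par : I → I} {lev : I → ℤ} (hlev : ∀ Q, lev (par Q) = lev Q + 1)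
    (w : I → ℝ≥0∞) (N : ℤ) : ∃ F, IsStoppingMap par lev w N F := by
  refine ⟨fun Q => stopAux par w (N - lev Q).toNat Q, ?_⟩
  have hw : ∀ x : ℝ≥0∞, x ≤ 2 * x := fun x => by rw [two_mul]; exact le_self_add
  have key : ∀ Q, lev Q < N → (N - lev Q).toNat = (N - lev (par Q)).toNat + 1 := by
    intro Q hQ
    rw [hlev]
    omega
  have top : ∀ Q, ¬ lev Q < N → (N - lev Q).toNat = 0 := by
    intro Q hQ
    omega
  refine ⟨fun Q => ?_, fun Q => ?_, fun Q hQ hF => ?_⟩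
  · by_cases hQ : lev Q < N
    · simp only [key Q hQ, stopAux]
      split_ifs with h
      · exact hw _
      · exact not_lt.1 h
    · simp only [top Q hQ, stopAux]
      exact hw _
  · by_cases hQ : lev Q < N
    · simp only [key Q hQ, stopAux]
      split_ifs with h
      · exact Or.inl rfl
      · exact Or.inr ⟨hQ, rfl⟩
    · simp only [top Q hQ, stopAux, true_or]
  · simp only [key Q hQ, stopAux] at hF ⊢
    split_ifs at hF with h
    · exact h.le
    -- A stopping ancestor inherited from the parent lies strictly above `Q`, so it cannot be `Q`.
    · have h1 := le_lev_stopAux hlev w (N - lev (par Q)).toNat (par Q)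
      rw [hF, hlev] at h1
      omega

theorem lev_iterate {par : I → I} {lev : I → ℤ} (hlev : ∀ Q, lev (par Q) = lev Q + 1) (j : ℕ)
    (Q : I) : lev (par^[j] Q) = lev Q + j := by
  induction j with
  | zero => simp
  | succ j ih =>
    rw [Function.iterate_succ_apply', hlev, ih]
    push_cast
    ring

namespace IsStoppingMap

variable {par : I → I} {lev : I → ℤ} {w : I → ℝ≥0∞} {N : ℤ} {F : I → I}

/-- Induction from the top of the tree downwards. It is well founded because every vertex at level
`N` or higher is its own stopping ancestor. -/
theorem induction_on (hlev : ∀ Q, lev (par Q) = lev Q + 1)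
    (hF : IsStoppingMap par lev w N F) {p : I → Prop} (hself : ∀ Q, F Q = Q → p Q)
    (hstep : ∀ Q, lev Q < N → F Q = F (par Q) → p (par Q) → p Q) (Q : I) : p Q := by
  obtain ⟨k, hk⟩ : ∃ k : ℕ, (N - lev Q).toNat = k := ⟨_, rfl⟩
  induction k generalizing Q with
  | zero =>
    rcases hF.self_or Q with h | ⟨h, -⟩
    · exact hself Q h
    · omega
  | succ k ih =>
    rcases hF.self_or Q with h | ⟨h, h'⟩
    · exact hself Q h
    · exact hstep Q h h' (ih _ (by rw [hlev]; omega))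

theorem exists_iterate (hlev : ∀ Q, lev (par Q) = lev Q + 1)
    (hF : IsStoppingMap par lev w N F) (Q : I) : ∃ j : ℕ, par^[j] Q = F Q := by
  refine hF.induction_on hlev (p := fun Q => ∃ j : ℕ, par^[j] Q = F Q) ?_ ?_ Q
  · exact fun Q h => ⟨0, h.symm⟩
  · rintro Q - h ⟨j, hj⟩
    exact ⟨j + 1, by rw [Function.iterate_succ_apply, hj, h]⟩

theorem idem (hlev : ∀ Q, lev (par Q) = lev Q + 1)
    (hF : IsStoppingMap par lev w N F) (Q : I) : F (F Q) = F Q := by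
  refine hF.induction_on hlev (p := fun Q => F (F Q) = F Q) ?_ ?_ Q
  · exact fun Q h => by rw [h, h]
  · exact fun Q _ h h' => by rw [h, h']

theorem lev_le (hlev : ∀ Q, lev (par Q) = lev Q + 1)
    (hF : IsStoppingMap par lev w N F) (Q : I) (hQ : lev Q ≤ N) : lev (F Q) ≤ N := by
  revert hQ
  refine hF.induction_on hlev (p := fun Q => lev Q ≤ N → lev (F Q) ≤ N) ?_ ?_ Q
  · exact fun Q h => by rw [h]; exact id
  · exact fun Q h1 h2 h3 _ => by rw [h2]; exact h3 (by rw [hlev]; omega)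

/-- The stopping map is constant between a vertex and its stopping ancestor. -/
theorem eq_of_between (hlev : ∀ Q, lev (par Q) = lev Q + 1)
    (hF : IsStoppingMap par lev w N F) (i : ℕ) (Q : I) (j : ℕ)
    (h : par^[j] (par^[i] Q) = F Q) : F (par^[i] Q) = F Q := by
  induction i generalizing Q with
  | zero => rfl
  | succ i ih =>
    rcases hF.self_or Q with h1 | ⟨-, h1⟩
    · have h2 := congrArg lev h
      rw [lev_iterate hlev, lev_iterate hlev, h1] at h2
      push_cast at h2
      omega
    · rw [Function.iterate_succ_apply] at h ⊢
      rw [h1] at h ⊢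
      exact ih _ h

/-- Along a branch of the tree, `w` grows geometrically over the stopping vertices. -/
theorem sum_le (hlev : ∀ Q, lev (par Q) = lev Q + 1)
    (hF : IsStoppingMap par lev w N F) (k : ℕ) (Q : I) (hk : (N - lev Q).toNat = k)
    (s : Finset I)
    (hs : ∀ R ∈ s, F R = R ∧ lev R ≤ N ∧ ∃ j : ℕ, par^[j] Q = R) :
    ∑ R ∈ s, w R ≤ 2 * w (F Q) := by
  classical
  induction k generalizing Q s with
  | zero =>
    have hsub : s ⊆ {Q} := by
      intro R hR
      obtain ⟨-, h2, j, hj⟩ := hs R hR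
      have h3 := lev_iterate hlev j Q
      rw [hj] at h3
      have : j = 0 := by omega
      subst this
      simpa using hj.symm
    calc ∑ R ∈ s, w R ≤ ∑ R ∈ {Q}, w R := Finset.sum_le_sum_of_subset hsub
      _ = w Q := by simp
      _ ≤ _ := hF.le_two_mul Q
  | succ k ih =>
    have hQ : lev Q < N := by omega
    have h1 : ∑ R ∈ s.erase Q, w R ≤ 2 * w (F (par Q)) := by
      refine ih (par Q) (by rw [hlev]; omega) _ fun R hR => ?_
      obtain ⟨hne, hR⟩ := Finset.mem_erase.1 hR
      obtain ⟨h1, h2, j, hj⟩ := hs R hR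
      refine ⟨h1, h2, ?_⟩
      cases j with
      | zero => exact absurd hj.symm hne
      | succ j => exact ⟨j, hj⟩
    by_cases hmem : Q ∈ s
    -- The doubling at a stopping vertex pays for everything above it: `w Q + 2 * w (F (par Q)) ≤ 2
    -- * w Q`.
    · have hFQ := (hs Q hmem).1
      rw [← Finset.add_sum_erase s w hmem, hFQ, two_mul]
      gcongr
      exact h1.trans (hF.jump Q hQ hFQ)
    · rw [Finset.erase_eq_of_notMem hmem] at h1
      rcases hF.self_or Q with h2 | ⟨-, h2⟩
      · refine h1.trans ((hF.jump Q hQ h2).trans ?_)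
        rw [h2, two_mul]
        exact le_self_add
      · rwa [h2]

end IsStoppingMap

/-- A family of sets of finite measure, indexed by a tree and nested like the tree. -/
structure IsTreeFamily {X : Type*} [MeasurableSpace X] (par : I → I) (lev : I → ℤ)
    (μ : Measure X) (A : I → Set X) : Prop where
  measurableSet : ∀ Q, MeasurableSet (A Q)
  measure_ne_top : ∀ Q, μ (A Q) ≠ ∞
  subset_par : ∀ Q, A Q ⊆ A (par Q)
  nested : ∀ x Q R, x ∈ A Q → x ∈ A R → lev Q ≤ lev R → ∃ j : ℕ, par^[j] Q = R

/-- The average of `f` over `A Q`, understood as `0` if `A Q` is a null set. -/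
def treeAverage {X : Type*} [MeasurableSpace X] (μ : Measure X) (A : I → Set X)
    (f : X → ℝ≥0∞) (Q : I) : ℝ≥0∞ := (∫⁻ x in A Q, f x ∂μ) / μ (A Q)

namespace IsTreeFamily

variable {X : Type*} [MeasurableSpace X] {par : I → I} {lev : I → ℤ} {μ : Measure X}
  {A : I → Set X}

theorem subset_iterate (hA : IsTreeFamily par lev μ A) (j : ℕ) (Q : I) :
    A Q ⊆ A (par^[j] Q) := by
  induction j with
  | zero => exact subset_rfl
  | succ j ih =>
    rw [Function.iterate_succ_apply']
    exact ih.trans (hA.subset_par _)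

theorem setLIntegral_eq (hA : IsTreeFamily par lev μ A) (f : X → ℝ≥0∞) (Q : I) :
    ∫⁻ x in A Q, f x ∂μ = treeAverage μ A f Q * μ (A Q) := by
  rcases eq_or_ne (μ (A Q)) 0 with h | h
  · rw [h, mul_zero, setLIntegral_measure_zero _ _ h]
  · rw [treeAverage, ENNReal.div_mul_cancel h (hA.measure_ne_top Q)]

theorem treeAverage_ne_top (hA : IsTreeFamily par lev μ A) {f : X → ℝ≥0∞} (hf : Measurable f)
    (h2 : ∫⁻ x, f x ^ 2 ∂μ ≠ ∞) (Q : I) : treeAverage μ A f Q ≠ ∞ := by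
  have h3 : ∫⁻ x in A Q, f x ∂μ ≠ ∞ := by
    have h := lintegral_mul_le_sqrt (μ.restrict (A Q)) hf.aemeasurable
      (aemeasurable_const (b := (1 : ℝ≥0∞)))
    simp only [mul_one, one_pow, lintegral_const, one_mul, Measure.restrict_apply_univ] at h
    refine ne_top_of_le_ne_top (ENNReal.mul_ne_top ?_ ?_) h
    · exact ENNReal.rpow_ne_top_of_nonneg (by norm_num)
        (ne_top_of_le_ne_top h2 (setLIntegral_le_lintegral _ _))
    · exact ENNReal.rpow_ne_top_of_nonneg (by norm_num) (hA.measure_ne_top Q)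
  rcases eq_or_ne (μ (A Q)) 0 with h | h
  · rw [treeAverage, setLIntegral_measure_zero _ _ h, ENNReal.zero_div]
    exact ENNReal.zero_ne_top
  · exact ENNReal.div_ne_top h3 h

/-- The Carleson embedding theorem for stopping vertices. -/
theorem sum_sq_treeAverage_le (hA : IsTreeFamily par lev μ A)
    (hlev : ∀ Q, lev (par Q) = lev Q + 1) {f : X → ℝ≥0∞} (hf : Measurable f) {N : ℤ} {F : I → I}
    (hF : IsStoppingMap par lev (treeAverage μ A f) N F) (s : Finset I)
    (hs : ∀ R ∈ s, F R = R ∧ lev R ≤ N) :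
    ∑ Q ∈ s, treeAverage μ A f Q ^ 2 * μ (A Q) ≤ 4 * ∫⁻ x, f x ^ 2 ∂μ := by
  classical
  rcases eq_or_ne (∫⁻ x, f x ^ 2 ∂μ) ∞ with h2 | h2
  · rw [h2, ENNReal.mul_top (by norm_num)]
    exact le_top
  set w := treeAverage μ A f with hw
  set S : X → ℝ≥0∞ := fun x => ∑ Q ∈ s, (A Q).indicator (fun _ => w Q) x with hS
  set X₀ := ∑ Q ∈ s, w Q ^ 2 * μ (A Q) with hX₀
  have hSm : Measurable S :=
    Finset.measurable_sum _ fun Q _ => measurable_const.indicator (hA.measurableSet Q)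
  -- Finiteness is what allows `X₀` to be absorbed at the end, from `X₀ = ∫ f S` and `∫ S² ≤ 4 X₀`.
  have hfin : X₀ ≠ ∞ := by
    refine ENNReal.sum_ne_top.2 fun Q _ => ENNReal.mul_ne_top ?_ (hA.measure_ne_top Q)
    exact ENNReal.pow_ne_top (hA.treeAverage_ne_top hf h2 Q)
  -- The sets that contain `x` belong to one branch, so by geometric growth `S x` is at most twice
  -- its term of lowest level. This takes the place of a maximal inequality.
  have hpt : ∀ x, S x ^ 2 ≤ 4 * ∑ Q ∈ s, (A Q).indicator (fun _ => w Q ^ 2) x := by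
    intro x
    have hfil : ∀ v : I → ℝ≥0∞, ∑ Q ∈ s, (A Q).indicator (fun _ => v Q) x =
        ∑ Q ∈ s.filter (fun Q => x ∈ A Q), v Q := by
      intro v
      rw [Finset.sum_filter]
      rfl
    simp only [hS]
    rw [hfil, hfil]
    rcases (s.filter (fun Q => x ∈ A Q)).eq_empty_or_nonempty with he | hne
    · simp [he]
    obtain ⟨Q, hQ, hmin⟩ := Finset.exists_min_image _ lev hne
    have hQ' := Finset.mem_filter.1 hQ
    have h1 : ∑ R ∈ s.filter (fun Q => x ∈ A Q), w R ≤ 2 * w (F Q) := by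
      refine hF.sum_le hlev _ Q rfl _ fun R hR => ?_
      have hR' := Finset.mem_filter.1 hR
      exact ⟨(hs R hR'.1).1, (hs R hR'.1).2, hA.nested x Q R hQ'.2 hR'.2 (hmin R hR)⟩
    rw [(hs Q hQ'.1).1] at h1
    calc _ ≤ (2 * w Q) ^ 2 := by gcongr
      _ = 4 * w Q ^ 2 := by ring
      _ ≤ _ := by
        gcongr
        exact Finset.single_le_sum (f := fun Q => w Q ^ 2) (fun _ _ => zero_le) hQ
  have h1 : X₀ ≤ ∫⁻ x, f x * S x ∂μ := by
    calc X₀ = ∑ Q ∈ s, ∫⁻ x, f x * (A Q).indicator (fun _ => w Q) x ∂μ := by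
          refine Finset.sum_congr rfl fun Q _ => ?_
          have : ∀ x, f x * (A Q).indicator (fun _ => w Q) x =
              (A Q).indicator (fun x => f x * w Q) x := by
            intro x
            by_cases hx : x ∈ A Q <;> simp [hx]
          simp_rw [this]
          rw [lintegral_indicator (hA.measurableSet Q), lintegral_mul_const _ hf,
            hA.setLIntegral_eq]
          ring
      _ = ∫⁻ x, ∑ Q ∈ s, f x * (A Q).indicator (fun _ => w Q) x ∂μ := by
          rw [lintegral_finsetSum]
          exact fun Q _ => hf.mul (measurable_const.indicator (hA.measurableSet Q))
      _ = _ := by simp_rw [hS, Finset.mul_sum]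
      _ ≤ _ := le_rfl
  have h3 : ∫⁻ x, S x ^ 2 ∂μ ≤ 4 * X₀ := by
    calc _ ≤ ∫⁻ x, 4 * ∑ Q ∈ s, (A Q).indicator (fun _ => w Q ^ 2) x ∂μ := lintegral_mono hpt
      _ = 4 * X₀ := by
        rw [lintegral_const_mul, lintegral_finsetSum]
        · congr 1
          refine Finset.sum_congr rfl fun Q _ => ?_
          rw [lintegral_indicator (hA.measurableSet Q), setLIntegral_const]
        · exact fun Q _ => measurable_const.indicator (hA.measurableSet Q)
        · exact Finset.measurable_sum _
            fun Q _ => measurable_const.indicator (hA.measurableSet Q)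
  have h4 : X₀ ≤ ((4 * ∫⁻ x, f x ^ 2 ∂μ) ^ (1 / 2 : ℝ)) * X₀ ^ (1 / 2 : ℝ) := by
    calc X₀ ≤ _ := h1
      _ ≤ _ := lintegral_mul_le_sqrt μ hf.aemeasurable hSm.aemeasurable
      _ ≤ (∫⁻ x, f x ^ 2 ∂μ) ^ (1 / 2 : ℝ) * (4 * X₀) ^ (1 / 2 : ℝ) := by
        gcongr
      _ = _ := by
        rw [ENNReal.mul_sqrt, ENNReal.mul_sqrt]
        ring
  have h5 := ENNReal.sqrt_le_of_le_mul_sqrt hfin h4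
  calc X₀ = (X₀ ^ (1 / 2 : ℝ)) ^ 2 := (ENNReal.sq_sqrt _).symm
    _ ≤ ((4 * ∫⁻ x, f x ^ 2 ∂μ) ^ (1 / 2 : ℝ)) ^ 2 := by gcongr
    _ = _ := ENNReal.sq_sqrt _

end IsTreeFamily

end Tree

/-! ### A two-weight theorem for sibling pairs, by parallel stopping vertices. -/

section Bilinear

variable {I X Y ι : Type*} [MeasurableSpace X] [MeasurableSpace Y] {par : I → I} {lev : I → ℤ}
  {μ : Measure X} {ν : Measure Y} {A : I → Set X} {B : I → Set Y}

/-- Testing on the `A` side: the part of the dual operator that lives below `γ`, applied to the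
indicator of `B γ`, has norm at most `K √ν(B γ)`. -/
def TestingBound (par : I → I) (μ : Measure X) (ν : Measure Y) (A : I → Set X) (B : I → Set Y)
    (p q : ι → I) (c : ι → ℝ≥0∞) (T : Finset ι) (K : ℝ≥0∞) : Prop :=
  ∀ γ, ∀ s ⊆ T, (∀ t ∈ s, ∃ j : ℕ, par^[j] (par (p t)) = γ) →
    ∫⁻ x, (∑ t ∈ s, (A (p t)).indicator (fun _ => c t * ν (B (q t))) x) ^ 2 ∂μ ≤ K ^ 2 * ν (B γ)

theorem TestingBound.mono {p q : ι → I} {c : ι → ℝ≥0∞} {T T' : Finset ι} {K : ℝ≥0∞}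
    (h : TestingBound par μ ν A B p q c T K) (hT : T' ⊆ T) :
    TestingBound par μ ν A B p q c T' K :=
  fun γ s hs => h γ s (hs.trans hT)

/-- The part of the bilinear form in which the stopping vertices of the `g` side lie above those
of the `f` side. -/
theorem sum_stopping_le_of_testingBound (hlev : ∀ Q, lev (par Q) = lev Q + 1)
    (hA : IsTreeFamily par lev μ A) (hB : IsTreeFamily par lev ν B)
    {f : X → ℝ≥0∞} (hf : Measurable f) {g : Y → ℝ≥0∞} (hg : Measurable g) {N : ℤ} {F G : I → I}
    (hF : IsStoppingMap par lev (treeAverage μ A f) N F)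
    (hG : IsStoppingMap par lev (treeAverage ν B g) N G)
    (p q : ι → I) (c : ι → ℝ≥0∞) (T : Finset ι) {K : ℝ≥0∞}
    (hpq : ∀ t ∈ T, par (p t) = par (q t)) (hN : ∀ t ∈ T, lev (par (p t)) ≤ N)
    (hT : ∀ t ∈ T, G (q t) = G (par (q t)) ∧ ∃ j : ℕ, par^[j] (F (p t)) = G (q t))
    (hK : TestingBound par μ ν A B p q c T K) :
    ∑ t ∈ T, c t * (treeAverage μ A f (F (p t)) * μ (A (p t))) *
        (treeAverage ν B g (G (q t)) * ν (B (q t))) ≤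
      8 * K * ((∫⁻ x, f x ^ 2 ∂μ) ^ (1 / 2 : ℝ) * (∫⁻ y, g y ^ 2 ∂ν) ^ (1 / 2 : ℝ)) := by
  classical
  set w := treeAverage μ A f with hw
  set v := treeAverage ν B g with hv
  set Γ := T.image fun t => G (q t) with hΓ
  set Tγ : I → Finset ι := fun γ => T.filter fun t => G (q t) = γ with hTγ
  set Φ := T.image fun t => F (p t) with hΦ
  set Φγ : I → Finset I := fun γ => (Tγ γ).image fun t => F (p t) with hΦγ
  have hNp : ∀ t ∈ T, lev (p t) ≤ N := fun t ht => by
    have := hN t ht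
    rw [hlev] at this
    omega
  have hNq : ∀ t ∈ T, lev (q t) ≤ N := fun t ht => by
    have := hN t ht
    rw [hpq t ht, hlev] at this
    omega
  have hind : ∀ (Q : I) (a : ℝ≥0∞), Measurable ((A Q).indicator fun _ => a) :=
    fun Q a => measurable_const.indicator (hA.measurableSet Q)
  -- For fixed `γ` the average of `g` is a constant. The averages of `f` are dominated on `A (p t)`
  -- by the square function `m` of the stopping vertices involved, and testing bounds the remaining
  -- factor `H`.
  have hlocal : ∀ γ, ∑ t ∈ Tγ γ, c t * (w (F (p t)) * μ (A (p t))) * (v (G (q t)) * ν (B (q t))) ≤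
      K * ((v γ * ν (B γ) ^ (1 / 2 : ℝ)) *
        (∑ φ ∈ Φγ γ, w φ ^ 2 * μ (A φ)) ^ (1 / 2 : ℝ)) := by
    intro γ
    set H : X → ℝ≥0∞ := fun x =>
      ∑ t ∈ Tγ γ, (A (p t)).indicator (fun _ => c t * ν (B (q t))) x with hH
    set m : X → ℝ≥0∞ := fun x =>
      (∑ φ ∈ Φγ γ, (A φ).indicator (fun _ => w φ ^ 2) x) ^ (1 / 2 : ℝ) with hm
    have hHm : Measurable H := Finset.measurable_sum _ fun t _ => hind _ _
    have hmm : Measurable m :=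
      (Finset.measurable_sum _ fun t _ => hind _ _).pow_const _
    have hH2 : ∫⁻ x, H x ^ 2 ∂μ ≤ K ^ 2 * ν (B γ) := by
      refine hK γ _ (Finset.filter_subset _ _) fun t ht => ?_
      obtain ⟨htT, rfl⟩ := Finset.mem_filter.1 ht
      rw [(hT t htT).1, hpq t htT]
      exact hG.exists_iterate hlev _
    have hm2 : ∫⁻ x, m x ^ 2 ∂μ = ∑ φ ∈ Φγ γ, w φ ^ 2 * μ (A φ) := by
      simp only [hm, ENNReal.sq_sqrt]
      rw [lintegral_finsetSum _ fun φ _ => hind _ _]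
      refine Finset.sum_congr rfl fun φ _ => ?_
      rw [lintegral_indicator (hA.measurableSet φ), setLIntegral_const]
    have hmw : ∀ t ∈ Tγ γ, ∀ x ∈ A (p t), w (F (p t)) ≤ m x := by
      intro t ht x hx
      rw [← ENNReal.sqrt_sq (w (F (p t)))]
      refine ENNReal.sqrt_mono ?_
      have hx' : x ∈ A (F (p t)) := by
        obtain ⟨j, hj⟩ := hF.exists_iterate hlev (p t)
        rw [← hj]
        exact hA.subset_iterate j _ hx
      calc w (F (p t)) ^ 2 = (A (F (p t))).indicator (fun _ => w (F (p t)) ^ 2) x := by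
            rw [Set.indicator_of_mem hx']
        _ ≤ _ := Finset.single_le_sum (f := fun φ => (A φ).indicator (fun _ => w φ ^ 2) x)
            (fun _ _ => zero_le) (Finset.mem_image_of_mem (fun t => F (p t)) ht)
    have h1 : ∑ t ∈ Tγ γ, c t * ν (B (q t)) * w (F (p t)) * μ (A (p t)) ≤
        ∫⁻ x, H x * m x ∂μ := by
      calc _ = ∫⁻ x, ∑ t ∈ Tγ γ,
              (A (p t)).indicator (fun _ => c t * ν (B (q t)) * w (F (p t))) x ∂μ := by
            rw [lintegral_finsetSum _ fun φ _ => hind _ _]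
            refine Finset.sum_congr rfl fun t _ => ?_
            rw [lintegral_indicator (hA.measurableSet _), setLIntegral_const]
        _ ≤ _ := by
            refine lintegral_mono fun x => ?_
            simp only [hH]
            rw [Finset.sum_mul]
            refine Finset.sum_le_sum fun t ht => ?_
            by_cases hx : x ∈ A (p t)
            · simp only [Set.indicator_of_mem hx]
              gcongr
              exact hmw t ht x hx
            · simp [Set.indicator_of_notMem hx]
    calc _ = v γ * ∑ t ∈ Tγ γ, c t * ν (B (q t)) * w (F (p t)) * μ (A (p t)) := by
          rw [Finset.mul_sum]
          refine Finset.sum_congr rfl fun t ht => ?_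
          rw [(Finset.mem_filter.1 ht).2]
          ring
      _ ≤ v γ * ((∫⁻ x, H x ^ 2 ∂μ) ^ (1 / 2 : ℝ) * (∫⁻ x, m x ^ 2 ∂μ) ^ (1 / 2 : ℝ)) := by
          gcongr
          exact h1.trans (lintegral_mul_le_sqrt μ hHm.aemeasurable hmm.aemeasurable)
      _ ≤ v γ * ((K ^ 2 * ν (B γ)) ^ (1 / 2 : ℝ) *
          (∑ φ ∈ Φγ γ, w φ ^ 2 * μ (A φ)) ^ (1 / 2 : ℝ)) := by
          rw [hm2]
          gcongr
      _ = _ := by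
          rw [ENNReal.mul_sqrt, ENNReal.sqrt_sq]
          ring
  have hgpart : ∑ γ ∈ Γ, (v γ * ν (B γ) ^ (1 / 2 : ℝ)) ^ 2 ≤ 4 * ∫⁻ y, g y ^ 2 ∂ν := by
    have : ∀ γ, (v γ * ν (B γ) ^ (1 / 2 : ℝ)) ^ 2 = v γ ^ 2 * ν (B γ) := fun γ => by
      rw [mul_pow, ENNReal.sq_sqrt]
    simp_rw [this]
    refine hB.sum_sq_treeAverage_le hlev hg hG Γ fun R hR => ?_
    obtain ⟨t, ht, rfl⟩ := Finset.mem_image.1 hR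
    exact ⟨hG.idem hlev _, hG.lev_le hlev _ (hNq t ht)⟩
  have hfpart : ∑ φ ∈ Φ, w φ ^ 2 * μ (A φ) ≤ 4 * ∫⁻ x, f x ^ 2 ∂μ := by
    refine hA.sum_sq_treeAverage_le hlev hf hF Φ fun R hR => ?_
    obtain ⟨t, ht, rfl⟩ := Finset.mem_image.1 hR
    exact ⟨hF.idem hlev _, hF.lev_le hlev _ (hNp t ht)⟩
  -- Bounded overlap. If `p t` stops, then `φ = p t` and `γ` is read off at the common parent.
  -- Otherwise `φ` lies between the common parent and `γ`, where `G` is constant.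
  have hmult : ∀ γ φ, φ ∈ Φγ γ → γ = G φ ∨ γ = G (par φ) := by
    intro γ φ hφ
    obtain ⟨t, ht, rfl⟩ := Finset.mem_image.1 hφ
    obtain ⟨htT, rfl⟩ := Finset.mem_filter.1 ht
    obtain ⟨h1, j, hj⟩ := hT t htT
    rcases hF.self_or (p t) with h2 | ⟨-, h2⟩
    · right
      rw [h2, hpq t htT, h1]
    · left
      obtain ⟨i, hi⟩ := hF.exists_iterate hlev (par (p t))
      rw [h2, ← hi, h1, ← hpq t htT] at hj
      rw [h2, ← hi, h1, ← hpq t htT]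
      exact (hG.eq_of_between hlev i _ j hj).symm
  have hE : ∑ γ ∈ Γ, ∑ φ ∈ Φγ γ, w φ ^ 2 * μ (A φ) ≤ 2 * ∑ φ ∈ Φ, w φ ^ 2 * μ (A φ) := by
    rw [Finset.sum_comm' (t' := Φ) (s' := fun φ => Γ.filter fun γ => φ ∈ Φγ γ)]
    · rw [Finset.mul_sum]
      refine Finset.sum_le_sum fun φ _ => ?_
      rw [Finset.sum_const, nsmul_eq_mul]
      gcongr
      have hsub : (Γ.filter fun γ => φ ∈ Φγ γ) ⊆ {G φ, G (par φ)} := by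
        intro γ hγ
        have := hmult γ φ (Finset.mem_filter.1 hγ).2
        simpa using this
      exact_mod_cast (Finset.card_le_card hsub).trans Finset.card_le_two
    · intro γ φ
      simp only [Finset.mem_filter]
      constructor
      · rintro ⟨h1, h2⟩
        refine ⟨⟨h1, h2⟩, ?_⟩
        obtain ⟨t, ht, rfl⟩ := Finset.mem_image.1 h2
        exact Finset.mem_image_of_mem _ (Finset.mem_filter.1 ht).1
      · exact fun h => h.1
  calc _ = ∑ γ ∈ Γ, ∑ t ∈ Tγ γ,
        c t * (w (F (p t)) * μ (A (p t))) * (v (G (q t)) * ν (B (q t))) :=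
        (Finset.sum_fiberwise_of_maps_to (fun t ht => Finset.mem_image_of_mem _ ht) _).symm
    _ ≤ ∑ γ ∈ Γ, K * ((v γ * ν (B γ) ^ (1 / 2 : ℝ)) *
        (∑ φ ∈ Φγ γ, w φ ^ 2 * μ (A φ)) ^ (1 / 2 : ℝ)) := Finset.sum_le_sum fun γ _ => hlocal γ
    _ ≤ K * ((∑ γ ∈ Γ, (v γ * ν (B γ) ^ (1 / 2 : ℝ)) ^ 2) ^ (1 / 2 : ℝ) *
        (∑ γ ∈ Γ, ∑ φ ∈ Φγ γ, w φ ^ 2 * μ (A φ)) ^ (1 / 2 : ℝ)) := by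
        rw [← Finset.mul_sum]
        gcongr
        refine (ENNReal.sum_mul_le_sqrt _ _ _).trans_eq ?_
        simp_rw [ENNReal.sq_sqrt]
    -- The overlap 2 times the Carleson constant 4 is rounded up to `4 ^ 2`, so that the square
    -- roots are integers and the total is `2 * 4 = 8`.
    _ ≤ K * ((2 ^ 2 * ∫⁻ y, g y ^ 2 ∂ν) ^ (1 / 2 : ℝ) *
        (4 ^ 2 * ∫⁻ x, f x ^ 2 ∂μ) ^ (1 / 2 : ℝ)) := by
        gcongr
        · exact hgpart.trans_eq (by norm_num)
        · refine (hE.trans (mul_le_mul_right hfpart _)).trans ?_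
          rw [← mul_assoc]
          gcongr
          norm_num
    _ = _ := by
        rw [ENNReal.mul_sqrt, ENNReal.mul_sqrt, ENNReal.sqrt_sq, ENNReal.sqrt_sq]
        ring

/-- The part of the bilinear form in which both vertices are stopping vertices. -/
theorem sum_stopping_le_of_card (hlev : ∀ Q, lev (par Q) = lev Q + 1)
    (hA : IsTreeFamily par lev μ A) (hB : IsTreeFamily par lev ν B)
    {f : X → ℝ≥0∞} (hf : Measurable f) {g : Y → ℝ≥0∞} (hg : Measurable g) {N : ℤ} {F G : I → I}
    (hF : IsStoppingMap par lev (treeAverage μ A f) N F)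
    (hG : IsStoppingMap par lev (treeAverage ν B g) N G)
    (p q : ι → I) (c : ι → ℝ≥0∞) (T : Finset ι) {K : ℝ≥0∞}
    (hp : ∀ t ∈ T, F (p t) = p t ∧ lev (p t) ≤ N) (hq : ∀ t ∈ T, G (q t) = q t ∧ lev (q t) ≤ N)
    {D : ℕ} [DecidableEq I] (hpD : ∀ Q, (T.filter fun t => p t = Q).card ≤ D)
    (hqD : ∀ Q, (T.filter fun t => q t = Q).card ≤ D)
    (hK : ∀ t ∈ T, c t * (μ (A (p t)) * ν (B (q t))) ^ (1 / 2 : ℝ) ≤ K) :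
    ∑ t ∈ T, c t * (treeAverage μ A f (F (p t)) * μ (A (p t))) *
        (treeAverage ν B g (G (q t)) * ν (B (q t))) ≤
      4 * D * K * ((∫⁻ x, f x ^ 2 ∂μ) ^ (1 / 2 : ℝ) * (∫⁻ y, g y ^ 2 ∂ν) ^ (1 / 2 : ℝ)) := by
  have hcount : ∀ (r : ι → I) (e : I → ℝ≥0∞), (∀ Q, (T.filter fun t => r t = Q).card ≤ D) →
      ∑ t ∈ T, e (r t) ≤ D * ∑ Q ∈ T.image r, e Q := by
    intro r e hr
    rw [Finset.mul_sum, ← Finset.sum_fiberwise_of_maps_to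
      (fun t ht => Finset.mem_image_of_mem r ht)]
    refine Finset.sum_le_sum fun Q _ => ?_
    rw [Finset.sum_congr rfl (g := fun _ => e Q) fun t ht => by rw [(Finset.mem_filter.1 ht).2],
      Finset.sum_const, nsmul_eq_mul]
    gcongr
    exact hr Q
  set w := treeAverage μ A f with hw
  set v := treeAverage ν B g with hv
  have hfpart : ∑ t ∈ T, (w (p t) * μ (A (p t)) ^ (1 / 2 : ℝ)) ^ 2 ≤
      D * (4 * ∫⁻ x, f x ^ 2 ∂μ) := by
    simp_rw [mul_pow, ENNReal.sq_sqrt]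
    refine (hcount p (fun Q => w Q ^ 2 * μ (A Q)) hpD).trans ?_
    gcongr
    refine hA.sum_sq_treeAverage_le hlev hf hF _ fun R hR => ?_
    obtain ⟨t, ht, rfl⟩ := Finset.mem_image.1 hR
    exact hp t ht
  have hgpart : ∑ t ∈ T, (v (q t) * ν (B (q t)) ^ (1 / 2 : ℝ)) ^ 2 ≤
      D * (4 * ∫⁻ y, g y ^ 2 ∂ν) := by
    simp_rw [mul_pow, ENNReal.sq_sqrt]
    refine (hcount q (fun Q => v Q ^ 2 * ν (B Q)) hqD).trans ?_
    gcongr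
    refine hB.sum_sq_treeAverage_le hlev hg hG _ fun R hR => ?_
    obtain ⟨t, ht, rfl⟩ := Finset.mem_image.1 hR
    exact hq t ht
  calc _ ≤ ∑ t ∈ T, K * ((w (p t) * μ (A (p t)) ^ (1 / 2 : ℝ)) *
        (v (q t) * ν (B (q t)) ^ (1 / 2 : ℝ))) := by
        refine Finset.sum_le_sum fun t ht => ?_
        rw [(hp t ht).1, (hq t ht).1]
        refine le_trans (le_of_eq ?_) (mul_le_mul_left (hK t ht) _)
        rw [ENNReal.mul_sqrt]
        nth_rewrite 1 [← ENNReal.mul_self_sqrt (μ (A (p t))), ← ENNReal.mul_self_sqrt (ν (B (q t)))]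
        ring
    _ ≤ K * ((D * (4 * ∫⁻ x, f x ^ 2 ∂μ)) ^ (1 / 2 : ℝ) *
        (D * (4 * ∫⁻ y, g y ^ 2 ∂ν)) ^ (1 / 2 : ℝ)) := by
        rw [← Finset.mul_sum]
        gcongr
        refine (ENNReal.sum_mul_le_sqrt _ _ _).trans ?_
        gcongr
    _ = K * ((D ^ (1 / 2 : ℝ) * D ^ (1 / 2 : ℝ)) * (4 ^ (1 / 2 : ℝ) * 4 ^ (1 / 2 : ℝ)) *
        ((∫⁻ x, f x ^ 2 ∂μ) ^ (1 / 2 : ℝ) * (∫⁻ y, g y ^ 2 ∂ν) ^ (1 / 2 : ℝ))) := by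
        simp_rw [ENNReal.mul_sqrt]
        ring
    _ = _ := by
        rw [ENNReal.mul_self_sqrt, ENNReal.mul_self_sqrt]
        ring

/-- A two weight theorem for bilinear forms over pairs of siblings. -/
theorem bilinear_sum_le (hlev : ∀ Q, lev (par Q) = lev Q + 1)
    (hA : IsTreeFamily par lev μ A) (hB : IsTreeFamily par lev ν B)
    {f : X → ℝ≥0∞} (hf : Measurable f) {g : Y → ℝ≥0∞} (hg : Measurable g)
    (p q : ι → I) (c : ι → ℝ≥0∞) (T : Finset ι) {K₁ K₂ K₃ : ℝ≥0∞}
    (hpq : ∀ t ∈ T, par (p t) = par (q t))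
    {D : ℕ} [DecidableEq I] (hpD : ∀ Q, (T.filter fun t => p t = Q).card ≤ D)
    (hqD : ∀ Q, (T.filter fun t => q t = Q).card ≤ D)
    (hK₁ : ∀ t ∈ T, c t * (μ (A (p t)) * ν (B (q t))) ^ (1 / 2 : ℝ) ≤ K₁)
    (hK₂ : TestingBound par ν μ B A q p c T K₂) (hK₃ : TestingBound par μ ν A B p q c T K₃) :
    ∑ t ∈ T, c t * (∫⁻ x in A (p t), f x ∂μ) * (∫⁻ y in B (q t), g y ∂ν) ≤
      (16 * D * K₁ + 32 * K₂ + 32 * K₃) *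
        ((∫⁻ x, f x ^ 2 ∂μ) ^ (1 / 2 : ℝ) * (∫⁻ y, g y ^ 2 ∂ν) ^ (1 / 2 : ℝ)) := by
  classical
  obtain ⟨N, hN⟩ : ∃ N, ∀ t ∈ T, lev (par (p t)) ≤ N := by
    obtain ⟨N, hN⟩ := (T.image fun t => lev (par (p t))).exists_le
    exact ⟨N, fun t ht => hN _ (Finset.mem_image_of_mem _ ht)⟩
  obtain ⟨F, hF⟩ := exists_isStoppingMap hlev (treeAverage μ A f) N
  obtain ⟨G, hG⟩ := exists_isStoppingMap hlev (treeAverage ν B g) N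
  set w := treeAverage μ A f with hw
  set v := treeAverage ν B g with hv
  set nf := (∫⁻ x, f x ^ 2 ∂μ) ^ (1 / 2 : ℝ)
  set ng := (∫⁻ y, g y ^ 2 ∂ν) ^ (1 / 2 : ℝ)
  set E : ι → ℝ≥0∞ := fun t =>
    c t * (w (F (p t)) * μ (A (p t))) * (v (G (q t)) * ν (B (q t))) with hE
  have hNp : ∀ t ∈ T, lev (p t) ≤ N := fun t ht => by
    have := hN t ht
    rw [hlev] at this
    omega
  have hNq : ∀ t ∈ T, lev (q t) ≤ N := fun t ht => by
    have := hN t ht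
    rw [hpq t ht, hlev] at this
    omega
  set T₁ := T.filter fun t => F (p t) = p t ∧ G (q t) = q t with hT₁
  set T₃ := T.filter fun t => G (q t) = G (par (q t)) ∧ ∃ j : ℕ, par^[j] (F (p t)) = G (q t)
    with hT₃
  set T₂ := T.filter fun t => F (p t) = F (par (p t)) ∧ ∃ j : ℕ, par^[j] (G (q t)) = F (p t)
    with hT₂
  -- Unless both members stop, some stopping ancestor comes from the common parent. The two
  -- ancestors then lie on one branch, and the higher one can be taken to belong to a member that
  -- inherits it.
  have hcover : T ⊆ T₁ ∪ T₂ ∪ T₃ := by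
    intro t ht
    simp only [hT₁, hT₂, hT₃, Finset.mem_union, Finset.mem_filter, ht, true_and]
    obtain ⟨i, hi⟩ := hF.exists_iterate hlev (par (p t))
    obtain ⟨j, hj⟩ := hG.exists_iterate hlev (par (q t))
    rcases hF.self_or (p t) with h1 | ⟨-, h1⟩ <;> rcases hG.self_or (q t) with h2 | ⟨-, h2⟩
    · exact Or.inl (Or.inl ⟨h1, h2⟩)
    · refine Or.inr ⟨h2, j + 1, ?_⟩
      rw [h1, Function.iterate_succ_apply, hpq t ht, hj, h2]
    · refine Or.inl (Or.inr ⟨h1, i + 1, ?_⟩)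
      rw [h2, Function.iterate_succ_apply, ← hpq t ht, hi, h1]
    · rw [h1, h2, ← hi, ← hj, ← hpq t ht]
      rcases le_total i j with hij | hij
      · refine Or.inr ⟨rfl, j - i, ?_⟩
        rw [← Function.iterate_add_apply, Nat.sub_add_cancel hij]
      · refine Or.inl (Or.inr ⟨rfl, i - j, ?_⟩)
        rw [← Function.iterate_add_apply, Nat.sub_add_cancel hij]
  have hfilter : ∀ (r : ι → I), (∀ Q, (T.filter fun t => r t = Q).card ≤ D) →
      ∀ Q, (T₁.filter fun t => r t = Q).card ≤ D := fun r h Q =>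
    (Finset.card_le_card (Finset.filter_subset_filter _ (Finset.filter_subset _ _))).trans (h Q)
  have h1 : ∑ t ∈ T₁, E t ≤ 4 * D * K₁ * (nf * ng) := by
    refine sum_stopping_le_of_card hlev hA hB hf hg hF hG p q c T₁ ?_ ?_
      ?_ ?_ ?_
    · intro t ht
      obtain ⟨ht, h⟩ := Finset.mem_filter.1 ht
      exact ⟨h.1, hNp t ht⟩
    · intro t ht
      obtain ⟨ht, h⟩ := Finset.mem_filter.1 ht
      exact ⟨h.2, hNq t ht⟩
    · exact hfilter p hpD
    · exact hfilter q hqD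
    · exact fun t ht => hK₁ t (Finset.mem_filter.1 ht).1
  have h3 : ∑ t ∈ T₃, E t ≤ 8 * K₃ * (nf * ng) := by
    refine sum_stopping_le_of_testingBound hlev hA hB hf hg hF hG p q c T₃ ?_ ?_ ?_
      (hK₃.mono (Finset.filter_subset _ _))
    · exact fun t ht => hpq t (Finset.mem_filter.1 ht).1
    · exact fun t ht => hN t (Finset.mem_filter.1 ht).1
    · exact fun t ht => (Finset.mem_filter.1 ht).2
  have h2 : ∑ t ∈ T₂, E t ≤ 8 * K₂ * (nf * ng) := by
    rw [mul_comm nf ng]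
    refine le_trans (le_of_eq ?_) (sum_stopping_le_of_testingBound hlev hB hA hg hf hG hF q p c T₂
      ?_ ?_ ?_ (hK₂.mono (Finset.filter_subset _ _)))
    · exact Finset.sum_congr rfl fun t _ => by simp only [hE]; ring
    · exact fun t ht => (hpq t (Finset.mem_filter.1 ht).1).symm
    · exact fun t ht => by
        rw [← hpq t (Finset.mem_filter.1 ht).1]
        exact hN t (Finset.mem_filter.1 ht).1
    · exact fun t ht => (Finset.mem_filter.1 ht).2
  -- The factor 4 is the price of passing to the stopping averages, 2 on each side.
  calc _ ≤ ∑ t ∈ T, 4 * E t := by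
        refine Finset.sum_le_sum fun t _ => ?_
        rw [hA.setLIntegral_eq, hB.setLIntegral_eq]
        calc _ ≤ c t * (2 * w (F (p t)) * μ (A (p t))) * (2 * v (G (q t)) * ν (B (q t))) := by
              gcongr
              · exact hF.le_two_mul _
              · exact hG.le_two_mul _
          _ = _ := by
              simp only [hE]
              ring
    _ ≤ 4 * (∑ t ∈ T₁, E t + ∑ t ∈ T₂, E t + ∑ t ∈ T₃, E t) := by
        rw [← Finset.mul_sum]
        gcongr
        calc _ ≤ ∑ t ∈ T₁ ∪ T₂ ∪ T₃, E t := Finset.sum_le_sum_of_subset hcover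
          _ ≤ ∑ t ∈ T₁ ∪ T₂, E t + ∑ t ∈ T₃, E t := by
              rw [← Finset.sum_union_inter]
              exact le_self_add
          _ ≤ _ := by
              gcongr
              rw [← Finset.sum_union_inter]
              exact le_self_add
    _ ≤ 4 * (4 * D * K₁ * (nf * ng) + 8 * K₂ * (nf * ng) + 8 * K₃ * (nf * ng)) := by
        gcongr
    _ = _ := by ring

end Bilinear

namespace DyadicGrid

variable {n : ℕ} (C : DyadicGrid n)

/-! ### Geometry of the cubes and boxes of the grid. -/

section Geometry

theorem fst_parent (R : Index n) : (C.parent R).1 = R.1 + 1 := rfl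

theorem fst_iterate_parent (j : ℕ) (R : Index n) : (C.parent^[j] R).1 = R.1 + j :=
  lev_iterate (lev := fun R : Index n => R.1) C.fst_parent j R

theorem side_iterate_parent (j : ℕ) (R : Index n) : C.side (C.parent^[j] R) = 2 ^ j * C.side R := by
  induction j with
  | zero => simp
  | succ j ih => rw [Function.iterate_succ_apply', side_parent, ih, pow_succ]; ring

theorem cube_subset_iterate (j : ℕ) (R : Index n) : C.cube R ⊆ C.cube (C.parent^[j] R) := by
  induction j with
  | zero => exact subset_rfl
  | succ j ih =>
    rw [Function.iterate_succ_apply']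
    exact ih.trans (C.cube_subset_parent _)

theorem measurableSet_cube (R : Index n) : MeasurableSet (C.cube R) := by
  have : C.cube R = Set.univ.pi fun i => Set.Ico (C.corner R i) (C.corner R i + C.side R) := by
    ext x
    simp [cube]
  rw [this]
  exact MeasurableSet.univ_pi fun i => measurableSet_Ico

theorem measurableSet_box (R : Index n) : MeasurableSet (C.box R) :=
  (C.measurableSet_cube R).prod measurableSet_Icc

/-- The cube of level `k` that contains `x`. -/
def cubeAt (k : ℤ) (x : Fin n → ℝ) : Index n :=
  (k, fun i => ⌊(x i - C.origin k i) / (C.scale * 2 ^ k)⌋)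

theorem mem_cube_iff {R : Index n} {x : Fin n → ℝ} : x ∈ C.cube R ↔ C.cubeAt R.1 x = R := by
  have hs : 0 < C.scale * 2 ^ R.1 := C.side_pos R
  rw [cubeAt, Prod.ext_iff, funext_iff]
  simp only [true_and]
  refine forall_congr' fun i => ?_
  rw [Int.floor_eq_iff, le_div_iff₀ hs, div_lt_iff₀ hs]
  simp only [corner, side]
  constructor <;> rintro ⟨h1, h2⟩ <;> constructor <;> linarith

theorem mem_cube_cubeAt (k : ℤ) (x : Fin n → ℝ) : x ∈ C.cube (C.cubeAt k x) :=
  C.mem_cube_iff.2 rfl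

theorem eq_of_mem_cube {Q R : Index n} {x : Fin n → ℝ} (h : Q.1 = R.1) (hQ : x ∈ C.cube Q)
    (hR : x ∈ C.cube R) : Q = R := by
  rw [mem_cube_iff] at hQ hR
  rw [← hQ, ← hR, h]

theorem exists_iterate_of_mem {Q R : Index n} {x : Fin n → ℝ} (h : Q.1 ≤ R.1)
    (hQ : x ∈ C.cube Q) (hR : x ∈ C.cube R) : ∃ j : ℕ, C.parent^[j] Q = R := by
  refine ⟨(R.1 - Q.1).toNat, C.eq_of_mem_cube (x := x) ?_ (C.cube_subset_iterate _ _ hQ) hR⟩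
  rw [fst_iterate_parent]
  omega

theorem center_mem_cube (R : Index n) : C.center R ∈ C.cube R := fun i => by
  have := C.side_pos R
  simp only [center]
  constructor <;> linarith

theorem whitneyCenter_mem_box (R : Index n) : C.whitneyCenter R ∈ C.box R := by
  refine ⟨C.center_mem_cube R, ?_, ?_⟩ <;> have := C.side_pos R <;>
    simp only [whitneyCenter] <;> linarith

theorem box_subset_box {Q R : Index n} (h : C.cube Q ⊆ C.cube R) (h' : C.side Q ≤ C.side R) :
    C.box Q ⊆ C.box R :=
  Set.prod_mono h (Set.Icc_subset_Icc_right h')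

theorem box_subset_parent (R : Index n) : C.box R ⊆ C.box (C.parent R) :=
  C.box_subset_box (C.cube_subset_parent R) (by rw [side_parent]; linarith [C.side_pos R])

theorem box_subset_iterate (j : ℕ) (R : Index n) : C.box R ⊆ C.box (C.parent^[j] R) := by
  induction j with
  | zero => exact subset_rfl
  | succ j ih =>
    rw [Function.iterate_succ_apply']
    exact ih.trans (C.box_subset_parent _)

/-- Side lengths jump by a factor of at least 2, and 3/4 of 2 exceeds 1. Hence a box contains only
the Whitney centres of descendants of its cube. -/
theorem fst_le_of_side_le {Q R : Index n} (h : 3 / 4 * C.side Q ≤ C.side R) : Q.1 ≤ R.1 := by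
  by_contra! hlt
  have h1 : R.1 + 1 ≤ Q.1 := hlt
  have h2 : C.side R * 2 ≤ C.side Q := by
    have h3 : (2 : ℝ) ^ (R.1 + 1) ≤ 2 ^ Q.1 := zpow_le_zpow_right₀ (by norm_num) h1
    rw [zpow_add₀ two_ne_zero, zpow_one] at h3
    simp only [side]
    rw [mul_assoc]
    exact mul_le_mul_of_nonneg_left h3 C.scale_pos.le
  linarith [C.side_pos R]

theorem exists_iterate_of_whitneyCenter_mem {Q R : Index n} (h : C.whitneyCenter Q ∈ C.box R) :
    ∃ j : ℕ, C.parent^[j] Q = R :=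
  C.exists_iterate_of_mem (C.fst_le_of_side_le h.2.2) (C.center_mem_cube Q) h.1

theorem iterate_parent_injective (R : Index n) :
    Function.Injective fun j : ℕ => C.parent^[j] R := by
  intro i j h
  have := congrArg Prod.fst h
  simp only [fst_iterate_parent] at this
  omega

/-- This lifts inclusions from cubes to boxes. It fails for `n = 0`, where every cube is the same
single point. -/
theorem side_le_of_cube_subset (hn : 1 ≤ n) {Q R : Index n} (h : C.cube Q ⊆ C.cube R) :
    C.side Q ≤ C.side R := by
  by_contra! hlt
  have hR := C.side_pos R
  have hQ := C.side_pos Q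
  have h0 : C.corner Q ∈ C.cube R := h fun i => ⟨le_rfl, by linarith⟩
  have h1 : (fun i => C.corner Q i + C.side R) ∈ C.cube R :=
    h fun i => ⟨by linarith, by linarith⟩
  have h2 := (h0 ⟨0, hn⟩).1
  have h3 := (h1 ⟨0, hn⟩).2
  simp only at h3
  linarith

theorem box_subset_of_parent_subset (hn : 1 ≤ n) {Q R : Index n}
    (h : C.cube (C.parent Q) ⊆ C.cube R) : C.box Q ⊆ C.box R :=
  (C.box_subset_parent Q).trans (C.box_subset_box h (C.side_le_of_cube_subset hn h))

theorem measure_cube_ne_top (σ : Measure (Fin n → ℝ)) [IsLocallyFiniteMeasure σ] (R : Index n) :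
    σ (C.cube R) ≠ ∞ := by
  have h : C.cube R ⊆ Set.Icc (C.corner R) (fun i => C.corner R i + C.side R) :=
    fun x hx => ⟨fun i => (hx i).1, fun i => (hx i).2.le⟩
  exact ((measure_mono h).trans_lt isCompact_Icc.measure_lt_top).ne

theorem measure_box_ne_top {ν : Measure ((Fin n → ℝ) × ℝ)}
    (hν : ∀ a b : (Fin n → ℝ) × ℝ, ν (Set.Icc a b) < ∞) (R : Index n) : ν (C.box R) ≠ ∞ := by
  have h : C.box R ⊆
      Set.Icc (C.corner R, 0) ((fun i => C.corner R i + C.side R), C.side R) :=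
    fun x hx => ⟨⟨fun i => (hx.1 i).1, hx.2.1⟩, ⟨fun i => (hx.1 i).2.le, hx.2.2⟩⟩
  exact ((measure_mono h).trans_lt (hν _ _)).ne

theorem isTreeFamily_cube (σ : Measure (Fin n → ℝ)) [IsLocallyFiniteMeasure σ] :
    IsTreeFamily C.parent Prod.fst σ C.cube :=
  ⟨C.measurableSet_cube, C.measure_cube_ne_top σ, C.cube_subset_parent,
    fun _ _ _ h1 h2 h3 => C.exists_iterate_of_mem h3 h1 h2⟩

/-- Boxes of different levels overlap vertically, but the tree structure is already decided by their
projections to the cubes. -/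
theorem isTreeFamily_box {ν : Measure ((Fin n → ℝ) × ℝ)}
    (hν : ∀ a b : (Fin n → ℝ) × ℝ, ν (Set.Icc a b) < ∞) :
    IsTreeFamily C.parent Prod.fst ν C.box :=
  ⟨C.measurableSet_box, C.measure_box_ne_top hν, C.box_subset_parent,
    fun _ _ _ h1 h2 h3 => C.exists_iterate_of_mem h3 h1.1 h2.1⟩

end Geometry

/-! ### Holes as unions of siblings, and the number of siblings. -/

section Siblings

/-- The siblings of `R`: the other cubes with the same parent. -/
abbrev Sibling (R : Index n) : Type := {S : Index n // C.parent S = C.parent R ∧ S ≠ R}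

/-- Ordered pairs of siblings. -/
abbrev SiblingPair : Type := Σ R : Index n, C.Sibling R

theorem fst_eq_of_parent_eq {Q R : Index n} (h : C.parent Q = C.parent R) : Q.1 = R.1 := by
  have := congrArg Prod.fst h
  simp only [fst_parent] at this
  omega

theorem parent_sdiff_eq_iUnion (R : Index n) :
    C.cube (C.parent R) \ C.cube R = ⋃ S : C.Sibling R, C.cube S.1 := by
  ext x
  simp only [Set.mem_sdiff, Set.mem_iUnion]
  constructor
  · rintro ⟨h1, h2⟩
    refine ⟨⟨C.cubeAt R.1 x, ?_, ?_⟩, C.mem_cube_cubeAt _ _⟩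
    · exact C.eq_of_mem_cube rfl (C.cube_subset_parent _ (C.mem_cube_cubeAt _ _)) h1
    · exact fun h => h2 (C.mem_cube_iff.2 h)
  · rintro ⟨⟨S, h1, h2⟩, hx⟩
    refine ⟨h1 ▸ C.cube_subset_parent S hx, fun hR => h2 ?_⟩
    exact C.eq_of_mem_cube (C.fst_eq_of_parent_eq h1) hx hR

theorem pairwise_disjoint_siblings (R : Index n) :
    Pairwise (Function.onFun Disjoint fun S : C.Sibling R => C.cube S.1) := by
  intro S S' h
  refine Set.disjoint_left.2 fun x h1 h2 => h (Subtype.ext ?_)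
  exact C.eq_of_mem_cube ((C.fst_eq_of_parent_eq S.2.1).trans
    (C.fst_eq_of_parent_eq S'.2.1).symm) h1 h2

theorem setLIntegral_parent_sdiff (σ : Measure (Fin n → ℝ)) (φ : (Fin n → ℝ) → ℝ≥0∞)
    (R : Index n) :
    ∫⁻ x in C.cube (C.parent R) \ C.cube R, φ x ∂σ =
      ∑' S : C.Sibling R, ∫⁻ x in C.cube S.1, φ x ∂σ := by
  rw [parent_sdiff_eq_iUnion]
  exact lintegral_iUnion (fun S => C.measurableSet_cube _) (C.pairwise_disjoint_siblings R) φ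

theorem measure_parent_sdiff (σ : Measure (Fin n → ℝ)) (R : Index n) :
    σ (C.cube (C.parent R) \ C.cube R) = ∑' S : C.Sibling R, σ (C.cube S.1) := by
  simpa using C.setLIntegral_parent_sdiff σ 1 R

theorem cube_sibling_subset {R : Index n} (S : C.Sibling R) :
    C.cube S.1 ⊆ C.cube (C.parent R) \ C.cube R := by
  rw [parent_sdiff_eq_iUnion]
  exact Set.subset_iUnion (fun S : C.Sibling R => C.cube S.1) S

/-- This is `setLIntegral_parent_sdiff` for the Dirac mass at `x`. -/
theorem tsum_indicator_sibling (R : Index n) (a : ℝ≥0∞) (x : Fin n → ℝ) :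
    ∑' S : C.Sibling R, (C.cube S.1).indicator (fun _ => a) x =
      (C.cube (C.parent R) \ C.cube R).indicator (fun _ => a) x := by
  have h := C.setLIntegral_parent_sdiff (Measure.dirac x) (fun _ => a) R
  simp only [setLIntegral_const] at h
  rw [Measure.dirac_apply' _ ((C.measurableSet_cube _).diff (C.measurableSet_cube _))] at h
  simp_rw [Measure.dirac_apply' _ (C.measurableSet_cube _)] at h
  have key : ∀ s : Set (Fin n → ℝ), s.indicator (fun _ => a) x = a * s.indicator 1 x := by
    intro s
    by_cases hx : x ∈ s <;> simp [hx]
  simp_rw [key]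
  exact h.symm

/-- A cube is determined by its parent and the parities of its coordinates. -/
theorem eq_of_parent_eq_of_parity {Q R : Index n} (h : C.parent Q = C.parent R)
    (h2 : ∀ i, Q.2 i % 2 = R.2 i % 2) : Q = R := by
  have hlev := C.fst_eq_of_parent_eq h
  refine Prod.ext hlev (funext fun i => ?_)
  obtain ⟨z, hz⟩ := C.nested R.1 i
  have hs := C.side_pos R
  have hsR : C.scale * 2 ^ R.1 = C.side R := rfl
  -- The parent's coordinate is an integer quotient by 2, so the parity restores what the division
  -- loses.
  have key : ∀ S : Index n, S.1 = R.1 → (C.parent S).2 i = (S.2 i - z) / 2 := by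
    intro S hS
    have hside : C.side S = C.side R := by simp only [side, hS]
    have h3 : (C.corner S i - C.origin (S.1 + 1) i) / (C.scale * 2 ^ (S.1 + 1)) =
        ((S.2 i - z : ℤ) : ℝ) / (2 : ℕ) := by
      have h4 : C.scale * 2 ^ (S.1 + 1) = 2 * C.side R := by
        rw [← hside]
        exact C.side_parent S
      rw [h4, corner, hside, hS, eq_add_of_sub_eq hz, hsR]
      push_cast
      field_simp
      ring
    simp only [parent]
    rw [h3, Int.floor_div_natCast, Int.floor_intCast]
    norm_num
  have h3 := key Q hlev
  rw [h, key R rfl] at h3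
  have := h2 i
  omega

theorem card_le_of_parent_eq (s : Finset (Index n)) (P : Index n)
    (hs : ∀ R ∈ s, C.parent R = P) : s.card ≤ 2 ^ n := by
  classical
  have h : s.card ≤ (Finset.univ : Finset (Fin n → Bool)).card := by
    refine Finset.card_le_card_of_injOn (fun R i => decide (R.2 i % 2 = 0))
      (fun _ _ => Finset.mem_coe.2 (Finset.mem_univ _)) fun Q hQ R hR hQR => ?_
    refine C.eq_of_parent_eq_of_parity ((hs Q hQ).trans (hs R hR).symm) fun i => ?_
    have := congrFun hQR i
    simp only [decide_eq_decide] at this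
    omega
  simpa using h

theorem card_filter_snd_le [DecidableEq (Index n)] (T : Finset C.SiblingPair) (Q : Index n) :
    (T.filter fun t => t.2.1 = Q).card ≤ 2 ^ n := by
  rw [← Finset.card_image_of_injOn (f := fun t : C.SiblingPair => t.1)]
  · refine C.card_le_of_parent_eq _ (C.parent Q) fun R hR => ?_
    obtain ⟨t, ht, rfl⟩ := Finset.mem_image.1 hR
    rw [← (Finset.mem_filter.1 ht).2]
    exact t.2.2.1.symm
  · rintro ⟨R, S, hS⟩ ht ⟨R', S', hS'⟩ ht' h
    have h1 := (Finset.mem_filter.1 (Finset.mem_coe.1 ht)).2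
    have h2 := (Finset.mem_filter.1 (Finset.mem_coe.1 ht')).2
    simp only at h h1 h2
    subst h h1 h2
    rfl

theorem card_filter_fst_le [DecidableEq (Index n)] (T : Finset C.SiblingPair) (Q : Index n) :
    (T.filter fun t => t.1 = Q).card ≤ 2 ^ n := by
  rw [← Finset.card_image_of_injOn (f := fun t : C.SiblingPair => t.2.1)]
  · refine C.card_le_of_parent_eq _ (C.parent Q) fun R hR => ?_
    obtain ⟨t, ht, rfl⟩ := Finset.mem_image.1 hR
    rw [← (Finset.mem_filter.1 ht).2]
    exact t.2.2.1
  · rintro ⟨R, S, hS⟩ ht ⟨R', S', hS'⟩ ht' h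
    have h1 := (Finset.mem_filter.1 (Finset.mem_coe.1 ht)).2
    have h2 := (Finset.mem_filter.1 (Finset.mem_coe.1 ht')).2
    simp only at h h1 h2
    subst h h1 h2
    rfl

end Siblings

end DyadicGrid

/-! ### Passage from finite to infinite sums in `L²`. -/

section Limits

theorem lintegral_sq_tsum_le {X β : Type*} [MeasurableSpace X] [Countable β] {μ : Measure X}
    {f : β → X → ℝ≥0∞} (hf : ∀ b, Measurable (f b)) {M : ℝ≥0∞}
    (h : ∀ s : Finset β, ∫⁻ x, (∑ b ∈ s, f b x) ^ 2 ∂μ ≤ M) :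
    ∫⁻ x, (∑' b, f b x) ^ 2 ∂μ ≤ M := by
  classical
  have hmono : ∀ x, Monotone fun s : Finset β => ∑ b ∈ s, f b x :=
    fun x s t hst => Finset.sum_le_sum_of_subset hst
  calc ∫⁻ x, (∑' b, f b x) ^ 2 ∂μ ≤ ∫⁻ x, ⨆ s : Finset β, (∑ b ∈ s, f b x) ^ 2 ∂μ := by
        refine lintegral_mono fun x => ?_
        simp only
        rw [ENNReal.tsum_eq_iSup_sum, sq, ENNReal.iSup_mul]
        refine iSup_le fun s => ?_
        rw [ENNReal.mul_iSup]
        refine iSup_le fun t => le_iSup_of_le (s ∪ t) ?_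
        rw [sq]
        exact mul_le_mul' (hmono x Finset.subset_union_left) (hmono x Finset.subset_union_right)
    _ = ⨆ s : Finset β, ∫⁻ x, (∑ b ∈ s, f b x) ^ 2 ∂μ := by
        refine lintegral_iSup_directed_of_measurable
          (fun s => (Finset.measurable_sum _ fun b _ => hf b).pow_const 2) ?_
        refine Monotone.directed_le fun s t hst x => ?_
        exact pow_le_pow_left' (hmono x hst) 2
    _ ≤ M := iSup_le h

theorem eLpNorm_two_sq {X : Type*} [MeasurableSpace X] (μ : Measure X) (f : X → ℝ≥0∞) :
    eLpNorm f 2 μ ^ 2 = ∫⁻ x, f x ^ 2 ∂μ := by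
  rw [eLpNorm_eq_lintegral_rpow_enorm_toReal (by norm_num) (by norm_num)]
  simp only [ENNReal.toReal_ofNat, enorm_eq_self, ENNReal.rpow_two]
  exact ENNReal.sq_sqrt _

theorem eLpNorm_two {X : Type*} [MeasurableSpace X] (μ : Measure X) (f : X → ℝ≥0∞) :
    eLpNorm f 2 μ = (∫⁻ x, f x ^ 2 ∂μ) ^ (1 / 2 : ℝ) := by
  rw [← eLpNorm_two_sq, ENNReal.sqrt_sq]

theorem lintegral_sq_sum_indicator {X β : Type*} [MeasurableSpace X] (μ : Measure X)
    {E : β → Set X} (hE : ∀ b, MeasurableSet (E b)) (a : β → ℝ≥0∞) (T : Finset β) :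
    ∫⁻ x, (∑ b ∈ T, (E b).indicator (fun _ => a b) x) ^ 2 ∂μ =
      ∑ b ∈ T, a b * ∫⁻ x in E b, ∑ b' ∈ T, (E b').indicator (fun _ => a b') x ∂μ := by
  have hm : Measurable fun x => ∑ b ∈ T, (E b).indicator (fun _ => a b) x :=
    Finset.measurable_sum _ fun b _ => measurable_const.indicator (hE b)
  calc _ = ∫⁻ x, ∑ b ∈ T, (E b).indicator
          (fun x => a b * ∑ b' ∈ T, (E b').indicator (fun _ => a b') x) x ∂μ := by
        refine lintegral_congr fun x => ?_
        rw [sq, Finset.sum_mul]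
        refine Finset.sum_congr rfl fun b _ => ?_
        by_cases hx : x ∈ E b <;> simp [hx]
    _ = _ := by
        rw [lintegral_finsetSum T fun b _ => (hm.const_mul (a b)).indicator (hE b)]
        refine Finset.sum_congr rfl fun b _ => ?_
        rw [lintegral_indicator (hE b), lintegral_const_mul _ hm]

/-- It supplies the finiteness that the absorption argument needs; this is why the estimates are
made on finite truncations. -/
theorem lintegral_sq_sum_indicator_ne_top {X β : Type*} [MeasurableSpace X] {μ : Measure X}
    {E : β → Set X} (hE : ∀ b, MeasurableSet (E b)) (hμ : ∀ b, μ (E b) ≠ ∞) {a : β → ℝ≥0∞}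
    (ha : ∀ b, a b ≠ ∞) (T : Finset β) :
    ∫⁻ x, (∑ b ∈ T, (E b).indicator (fun _ => a b) x) ^ 2 ∂μ ≠ ∞ := by
  rw [lintegral_sq_sum_indicator μ hE]
  refine ENNReal.sum_ne_top.2 fun b _ => ENNReal.mul_ne_top (ha b) ?_
  refine ne_top_of_le_ne_top ?_ (setLIntegral_le_lintegral _ _)
  rw [lintegral_finsetSum _ fun b' _ => measurable_const.indicator (hE b')]
  refine ENNReal.sum_ne_top.2 fun b' _ => ?_
  rw [lintegral_indicator (hE b'), setLIntegral_const]
  exact ENNReal.mul_ne_top (ha b') (hμ b')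

end Limits

namespace DyadicGrid

variable {n : ℕ} (C : DyadicGrid n)

/-! ### Comparison of the Poisson-type operator with a positive dyadic operator. -/

section Operator

theorem sidePow_ne_zero (d : ℝ) (R : Index n) : C.sidePow d R ≠ 0 := by
  have := Real.rpow_pos_of_pos (C.side_pos R) (d + 1)
  simpa [sidePow] using this

theorem sidePow_ne_top (d : ℝ) (R : Index n) : C.sidePow d R ≠ ∞ := ENNReal.ofReal_ne_top

theorem sidePow_parent (d : ℝ) (R : Index n) :
    C.sidePow d (C.parent R) = ENNReal.ofReal (2 ^ (d + 1)) * C.sidePow d R := by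
  rw [sidePow, side_parent, Real.mul_rpow (by norm_num) (C.side_pos R).le,
    ENNReal.ofReal_mul (by positivity), sidePow]

/-- The positive operator with holes
`φ ↦ ∑_R ℓ(R)^{-(d+1)} (∫_{R⁽¹⁾ \ R} φ dσ) 1_{Box_R}`. -/
def holesOp (d : ℝ) (σ : Measure (Fin n → ℝ)) (φ : (Fin n → ℝ) → ℝ≥0∞)
    (y : (Fin n → ℝ) × ℝ) : ℝ≥0∞ :=
  ∑' R : Index n, (C.box R).indicator
    (fun _ => (∫⁻ x in C.cube (C.parent R) \ C.cube R, φ x ∂σ) / C.sidePow d R) y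

theorem measurable_holesOp (d : ℝ) (σ : Measure (Fin n → ℝ)) (φ : (Fin n → ℝ) → ℝ≥0∞) :
    Measurable (C.holesOp d σ φ) :=
  Measurable.tsum fun R => measurable_const.indicator (C.measurableSet_box R)

/-- The boxes that contain the Whitney centre of `R` are exactly those of the ancestors of `R`. -/
theorem holesOp_whitneyCenter (d : ℝ) (σ : Measure (Fin n → ℝ)) (φ : (Fin n → ℝ) → ℝ≥0∞)
    (R : Index n) :
    C.holesOp d σ φ (C.whitneyCenter R) =
      ∑' i : ℕ, (∫⁻ x in C.cube (C.parent^[i + 1] R) \ C.cube (C.parent^[i] R), φ x ∂σ) /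
        C.sidePow d (C.parent^[i] R) := by
  rw [holesOp, ← (C.iterate_parent_injective R).tsum_eq]
  · refine tsum_congr fun i => ?_
    rw [Set.indicator_of_mem (C.box_subset_iterate i R (C.whitneyCenter_mem_box R)),
      Function.iterate_succ_apply']
  · intro S hS
    have : C.whitneyCenter R ∈ C.box S := by
      by_contra h
      exact hS (Set.indicator_of_notMem h _)
    exact C.exists_iterate_of_whitneyCenter_mem this

theorem poissonQ_eq (d : ℝ) (σ : Measure (Fin n → ℝ)) (φ : (Fin n → ℝ) → ℝ≥0∞) (R : Index n) :
    C.poissonQ d σ ((C.cube R)ᶜ.indicator φ) R =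
      ∑' j : ℕ, (∫⁻ x in C.cube (C.parent^[j] R) \ C.cube R, φ x ∂σ) /
        C.sidePow d (C.parent^[j] R) := by
  refine tsum_congr fun j => ?_
  rw [sidePow, side_iterate_parent, ancestor,
    setLIntegral_indicator (C.measurableSet_cube R).compl, Set.inter_comm, Set.sdiff_eq]

theorem setLIntegral_iterate_sdiff_le (σ : Measure (Fin n → ℝ)) (φ : (Fin n → ℝ) → ℝ≥0∞)
    (R : Index n) (j : ℕ) :
    ∫⁻ x in C.cube (C.parent^[j] R) \ C.cube R, φ x ∂σ ≤
      ∑ i ∈ Finset.range j,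
        ∫⁻ x in C.cube (C.parent^[i + 1] R) \ C.cube (C.parent^[i] R), φ x ∂σ := by
  induction j with
  | zero => simp
  | succ j ih =>
    rw [Finset.sum_range_succ]
    have hsub : C.cube (C.parent^[j + 1] R) \ C.cube R ⊆
        (C.cube (C.parent^[j] R) \ C.cube R) ∪
          (C.cube (C.parent^[j + 1] R) \ C.cube (C.parent^[j] R)) := by
      rintro x ⟨h1, h2⟩
      by_cases h : x ∈ C.cube (C.parent^[j] R)
      · exact Or.inl ⟨h, h2⟩
      · exact Or.inr ⟨h1, h⟩
    calc _ ≤ _ := lintegral_mono_set hsub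
      _ ≤ _ := lintegral_union_le _ _ _
      _ ≤ _ := by gcongr

theorem tsum_inv_sidePow_le {d : ℝ} (hd : 0 ≤ d) (R : Index n) :
    ∑' m : ℕ, (C.sidePow d (C.parent^[m + 1] R))⁻¹ ≤ (C.sidePow d R)⁻¹ := by
  have hstep : ∀ Q : Index n, (C.sidePow d (C.parent Q))⁻¹ ≤ 2⁻¹ * (C.sidePow d Q)⁻¹ := by
    intro Q
    rw [sidePow_parent, ENNReal.mul_inv (Or.inr (C.sidePow_ne_top d Q))
      (Or.inr (C.sidePow_ne_zero d Q))]
    gcongr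
    have h2 : (2 : ℝ) ≤ 2 ^ (d + 1) := by
      calc (2 : ℝ) = 2 ^ (1 : ℝ) := (Real.rpow_one 2).symm
        _ ≤ 2 ^ (d + 1) := Real.rpow_le_rpow_of_exponent_le (by norm_num) (by linarith)
    calc (2 : ℝ≥0∞) = ENNReal.ofReal 2 := by simp
      _ ≤ _ := ENNReal.ofReal_le_ofReal h2
  have hpow : ∀ m : ℕ, (C.sidePow d (C.parent^[m] R))⁻¹ ≤ 2⁻¹ ^ m * (C.sidePow d R)⁻¹ := by
    intro m
    induction m with
    | zero => simp
    | succ m ih =>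
      rw [Function.iterate_succ_apply', pow_succ']
      calc _ ≤ _ := hstep _
        _ ≤ 2⁻¹ * (2⁻¹ ^ m * (C.sidePow d R)⁻¹) := by gcongr
        _ = _ := by ring
  calc _ ≤ ∑' m : ℕ, (2⁻¹ : ℝ≥0∞) ^ (m + 1) * (C.sidePow d R)⁻¹ :=
        ENNReal.tsum_le_tsum fun m => hpow (m + 1)
    _ = (C.sidePow d R)⁻¹ := by
        rw [ENNReal.tsum_mul_right, ENNReal.tsum_geometric_add_one, ENNReal.one_sub_inv_two,
          inv_inv, ENNReal.inv_mul_cancel (by norm_num) (by norm_num), one_mul]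

/-- The Poisson-type operator with holes is dominated by `holesOp`. -/
theorem poissonQ_le_holesOp {d : ℝ} (hd : 0 ≤ d) (σ : Measure (Fin n → ℝ))
    (φ : (Fin n → ℝ) → ℝ≥0∞) (R : Index n) :
    C.poissonQ d σ ((C.cube R)ᶜ.indicator φ) R ≤ C.holesOp d σ φ (C.whitneyCenter R) := by
  rw [poissonQ_eq, holesOp_whitneyCenter]
  set J : ℕ → ℝ≥0∞ := fun i =>
    ∫⁻ x in C.cube (C.parent^[i + 1] R) \ C.cube (C.parent^[i] R), φ x ∂σ with hJ
  set b : ℕ → ℝ≥0∞ := fun j => (C.sidePow d (C.parent^[j] R))⁻¹ with hb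
  have hsum : ∀ i, ∑' j : ℕ, (if i < j then b j else 0) ≤ b i := by
    intro i
    rw [← (ENNReal.summable.sum_add_tsum_nat_add' (f := fun j => if i < j then b j else 0)
      (k := i + 1)), Finset.sum_eq_zero, zero_add]
    · have : ∀ m, (if i < m + (i + 1) then b (m + (i + 1)) else 0) =
          (C.sidePow d (C.parent^[m + 1] (C.parent^[i] R)))⁻¹ := by
        intro m
        rw [if_pos (by omega), ← Function.iterate_add_apply, hb]
        simp only [add_assoc, add_comm 1 i]
      simp_rw [this]
      exact C.tsum_inv_sidePow_le hd _
    · intro j hj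
      rw [if_neg (by have := Finset.mem_range.1 hj; omega)]
  -- Split into shells and exchange the sums: the shell `i` is counted for all `j > i`, and these
  -- weights sum to at most `b i`.
  calc _ ≤ ∑' j : ℕ, ∑' i : ℕ, (if i < j then J i * b j else 0) := by
        refine ENNReal.tsum_le_tsum fun j => ?_
        rw [div_eq_mul_inv]
        calc _ ≤ (∑ i ∈ Finset.range j, J i) * b j := by
              gcongr
              exact C.setLIntegral_iterate_sdiff_le σ φ R j
          _ = ∑ i ∈ Finset.range j, (if i < j then J i * b j else 0) := by
              rw [Finset.sum_mul]
              exact Finset.sum_congr rfl fun i hi => (if_pos (Finset.mem_range.1 hi)).symm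
          _ ≤ _ := ENNReal.sum_le_tsum _
    _ = ∑' i : ℕ, J i * ∑' j : ℕ, (if i < j then b j else 0) := by
        rw [ENNReal.tsum_comm]
        refine tsum_congr fun i => ?_
        rw [← ENNReal.tsum_mul_left]
        exact tsum_congr fun j => by rw [mul_ite, mul_zero]
    _ ≤ _ := by
        refine ENNReal.tsum_le_tsum fun i => ?_
        rw [div_eq_mul_inv]
        exact mul_le_mul_right (hsum i) _

/-- The shell `i` lies in the hole of the ancestor `i + 1`; the shift in the normalising side length
costs `2 ^ (d + 1)`. -/
theorem holesOp_le_poissonQ (d : ℝ) (σ : Measure (Fin n → ℝ))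
    (φ : (Fin n → ℝ) → ℝ≥0∞) (R : Index n) :
    C.holesOp d σ φ (C.whitneyCenter R) ≤
      ENNReal.ofReal (2 ^ (d + 1)) * C.poissonQ d σ ((C.cube R)ᶜ.indicator φ) R := by
  rw [poissonQ_eq, holesOp_whitneyCenter]
  set e := ENNReal.ofReal (2 ^ (d + 1)) with he
  have he0 : e ≠ 0 := by
    have : (0 : ℝ) < 2 ^ (d + 1) := Real.rpow_pos_of_pos (by norm_num) _
    simpa [he] using this
  have het : e ≠ ∞ := ENNReal.ofReal_ne_top
  set u : ℕ → ℝ≥0∞ := fun j => (∫⁻ x in C.cube (C.parent^[j] R) \ C.cube R, φ x ∂σ) /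
        C.sidePow d (C.parent^[j] R) with hu
  calc _ ≤ ∑' i : ℕ, e * u (i + 1) := by
        refine ENNReal.tsum_le_tsum fun i => ?_
        have h1 : e * u (i + 1) = (∫⁻ x in C.cube (C.parent^[i + 1] R) \ C.cube R, φ x ∂σ) /
            C.sidePow d (C.parent^[i] R) := by
          simp only [hu]
          rw [Function.iterate_succ_apply', sidePow_parent, ← he, ← mul_div_assoc,
            ENNReal.mul_div_mul_left _ _ he0 het]
        rw [h1]
        gcongr
        exact C.cube_subset_iterate i R
    _ ≤ _ := by
        rw [ENNReal.tsum_mul_left]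
        refine mul_le_mul_right ?_ _
        exact ENNReal.tsum_comp_le_tsum_of_injective (add_left_injective 1) u

theorem lintegral_etaMeasure (η : Index n → ℝ≥0) (h : (Fin n → ℝ) × ℝ → ℝ≥0∞) :
    ∫⁻ y, h y ∂(C.etaMeasure η) = ∑' R : Index n, h (C.whitneyCenter R) * (η R : ℝ≥0∞) := by
  rw [etaMeasure, lintegral_sum_measure]
  refine tsum_congr fun R => ?_
  rw [lintegral_smul_measure, lintegral_dirac, ENNReal.smul_def, smul_eq_mul, mul_comm]

end Operator

/-! ### Sufficiency of the testing conditions. -/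

section Sufficiency

theorem lintegral_sq_le_constQ₂ (d : ℝ) (σ : Measure (Fin n → ℝ)) [IsLocallyFiniteMeasure σ]
    (η : Index n → ℝ≥0) (γ : Index n) :
    ∫⁻ p, (∑' R : {R : Index n // C.cube (C.parent R) ⊆ C.cube γ},
        (C.box R).indicator
          (fun _ => σ (C.cube (C.parent R) \ C.cube R) / C.sidePow d R) p) ^ 2 ∂(C.etaMeasure η) ≤
      C.constQ₂ d σ η ^ 2 * σ (C.cube γ) := by
  rcases eq_or_ne (σ (C.cube γ)) 0 with h0 | h0
  · have : ∀ R : {R : Index n // C.cube (C.parent R) ⊆ C.cube γ},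
        σ (C.cube (C.parent R) \ C.cube R) = 0 := fun R =>
      measure_mono_null (Set.sdiff_subset.trans R.2) h0
    simp [this]
  rw [← eLpNorm_two_sq, ← ENNReal.sq_sqrt (σ (C.cube γ)), ← mul_pow]
  gcongr
  rw [← ENNReal.div_le_iff (by simp [h0]) (by simp [C.measure_cube_ne_top σ γ])]
  exact le_iSup (fun R₀ : Index n => eLpNorm (fun p =>
      ∑' R : {R : Index n // C.cube (C.parent R) ⊆ C.cube R₀}, (C.box R).indicator
        (fun _ => σ (C.cube (C.parent R) \ C.cube R) / C.sidePow d R) p)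
      2 (C.etaMeasure η) / σ (C.cube R₀) ^ (1 / 2 : ℝ)) γ

theorem lintegral_sq_le_constQ₃ (hn : 1 ≤ n) (d : ℝ) (σ : Measure (Fin n → ℝ))
    (η : Index n → ℝ≥0) (hη : ∀ a b : (Fin n → ℝ) × ℝ, C.etaMeasure η (Set.Icc a b) < ∞)
    (γ : Index n) :
    ∫⁻ x, (∑' R : {R : Index n // C.cube (C.parent R) ⊆ C.cube γ},
        (C.cube (C.parent R) \ C.cube R).indicator
          (fun _ => C.etaMeasure η (C.box R) / C.sidePow d R) x) ^ 2 ∂σ ≤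
      C.constQ₃ d σ η ^ 2 * C.etaMeasure η (C.box γ) := by
  rcases eq_or_ne (C.etaMeasure η (C.box γ)) 0 with h0 | h0
  · have : ∀ R : {R : Index n // C.cube (C.parent R) ⊆ C.cube γ},
        C.etaMeasure η (C.box R) = 0 := fun R =>
      measure_mono_null (C.box_subset_of_parent_subset hn R.2) h0
    simp [this]
  rw [← eLpNorm_two_sq, ← ENNReal.sq_sqrt (C.etaMeasure η (C.box γ)), ← mul_pow]
  gcongr
  rw [← ENNReal.div_le_iff (by simp [h0]) (by simp [C.measure_box_ne_top hη γ])]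
  exact le_iSup (fun R₀ : Index n => eLpNorm (fun x =>
      ∑' R : {R : Index n // C.cube (C.parent R) ⊆ C.cube R₀},
        (C.cube (C.parent R) \ C.cube R).indicator
          (fun _ => C.etaMeasure η (C.box R) / C.sidePow d R) x)
      2 σ / C.etaMeasure η (C.box R₀) ^ (1 / 2 : ℝ)) γ

/-- It links the two descriptions of what lies below `γ`: descent in the tree, as in `TestingBound`,
and inclusion of cubes, as in the testing constants. -/
theorem sum_siblingPair_le (u : C.SiblingPair → ℝ≥0∞) (γ : Index n) (s : Finset C.SiblingPair)
    (hs : ∀ t ∈ s, ∃ j : ℕ, C.parent^[j] (C.parent t.1) = γ) :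
    ∑ t ∈ s, u t ≤ ∑' R : {R : Index n // C.cube (C.parent R) ⊆ C.cube γ},
      ∑' S : C.Sibling R.1, u ⟨R.1, S⟩ := by
  set P : Set (Index n) := {R | C.cube (C.parent R) ⊆ C.cube γ} with hP
  calc ∑ t ∈ s, u t = ∑ t ∈ s, P.indicator (fun _ => u t) t.1 := by
        refine Finset.sum_congr rfl fun t ht => ?_
        obtain ⟨j, rfl⟩ := hs t ht
        exact (Set.indicator_of_mem (s := P) (C.cube_subset_iterate j _) fun _ => u t).symm
    _ ≤ ∑' t : C.SiblingPair, P.indicator (fun _ => u t) t.1 := ENNReal.sum_le_tsum _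
    _ = ∑' R : Index n, P.indicator (fun R => ∑' S : C.Sibling R, u ⟨R, S⟩) R := by
        rw [ENNReal.tsum_sigma']
        refine tsum_congr fun R => ?_
        by_cases hR : R ∈ P <;> simp [hR]
    _ = _ := (tsum_subtype P fun R => ∑' S : C.Sibling R, u ⟨R, S⟩).symm

theorem testingBound_constQ₃ (hn : 1 ≤ n) (d : ℝ) (σ : Measure (Fin n → ℝ))
    (η : Index n → ℝ≥0) (hη : ∀ a b : (Fin n → ℝ) × ℝ, C.etaMeasure η (Set.Icc a b) < ∞)
    (T : Finset C.SiblingPair) :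
    TestingBound C.parent σ (C.etaMeasure η) C.cube C.box
      (fun t : C.SiblingPair => t.2.1) (fun t => t.1) (fun t => (C.sidePow d t.1)⁻¹) T
      (C.constQ₃ d σ η) := by
  intro γ s _ hs
  refine le_trans (lintegral_mono fun x => ?_) (C.lintegral_sq_le_constQ₃ hn d σ η hη γ)
  refine pow_le_pow_left' ((C.sum_siblingPair_le _ γ s fun t ht => ?_).trans_eq ?_) 2
  · rw [← t.2.2.1]
    exact hs t ht
  · refine tsum_congr fun R => ?_
    rw [div_eq_mul_inv, mul_comm]
    exact C.tsum_indicator_sibling R.1 ((C.sidePow d R.1)⁻¹ * C.etaMeasure η (C.box R.1)) x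

theorem testingBound_constQ₂ (d : ℝ) (σ : Measure (Fin n → ℝ)) [IsLocallyFiniteMeasure σ]
    (η : Index n → ℝ≥0) (T : Finset C.SiblingPair) :
    TestingBound C.parent (C.etaMeasure η) σ C.box C.cube
      (fun t : C.SiblingPair => t.1) (fun t => t.2.1) (fun t => (C.sidePow d t.1)⁻¹) T
      (C.constQ₂ d σ η) := by
  intro γ s _ hs
  refine le_trans (lintegral_mono fun y => ?_) (C.lintegral_sq_le_constQ₂ d σ η γ)
  refine pow_le_pow_left' ((C.sum_siblingPair_le _ γ s hs).trans_eq ?_) 2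
  refine tsum_congr fun R => ?_
  by_cases hy : y ∈ C.box R.1
  · simp only [Set.indicator_of_mem hy]
    rw [ENNReal.tsum_mul_left, C.measure_parent_sdiff, div_eq_mul_inv, mul_comm]
  · simp [Set.indicator_of_notMem hy]

theorem inv_sidePow_mul_le_constQ₁ (d : ℝ) (σ : Measure (Fin n → ℝ)) (η : Index n → ℝ≥0)
    (t : C.SiblingPair) :
    (C.sidePow d t.1)⁻¹ * (σ (C.cube t.2.1) * C.etaMeasure η (C.box t.1)) ^ (1 / 2 : ℝ) ≤
      C.constQ₁ d σ η := by
  refine le_trans ?_ (le_iSup (fun R : Index n => (σ (C.cube (C.parent R) \ C.cube R) *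
    C.etaMeasure η (C.box R)) ^ (1 / 2 : ℝ) / C.sidePow d R) t.1)
  rw [ENNReal.div_eq_inv_mul]
  refine mul_le_mul_right (ENNReal.sqrt_mono (mul_le_mul_left (measure_mono ?_) _)) _
  exact C.cube_sibling_subset t.2

/-- The testing conditions bound the operator with holes. -/
theorem lintegral_holesOp_sq_le (hn : 1 ≤ n) (d : ℝ) (σ : Measure (Fin n → ℝ))
    [IsLocallyFiniteMeasure σ] (η : Index n → ℝ≥0)
    (hη : ∀ a b : (Fin n → ℝ) × ℝ, C.etaMeasure η (Set.Icc a b) < ∞)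
    {φ : (Fin n → ℝ) → ℝ≥0∞} (hφ : Measurable φ) (hφ2 : ∫⁻ x, φ x ^ 2 ∂σ ≠ ∞) :
    ∫⁻ y, C.holesOp d σ φ y ^ 2 ∂(C.etaMeasure η) ≤
      (32 * 2 ^ n * (C.constQ₁ d σ η + C.constQ₂ d σ η + C.constQ₃ d σ η)) ^ 2 *
        ∫⁻ x, φ x ^ 2 ∂σ := by
  classical
  set ν := C.etaMeasure η with hν
  have hA := C.isTreeFamily_cube σ
  have hB := C.isTreeFamily_box hη
  set a : C.SiblingPair → ℝ≥0∞ := fun t =>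
    (C.sidePow d t.1)⁻¹ * ∫⁻ x in C.cube t.2.1, φ x ∂σ with ha
  have ha_top : ∀ t, a t ≠ ∞ := by
    intro t
    refine ENNReal.mul_ne_top (ENNReal.inv_ne_top.2 (C.sidePow_ne_zero d _)) ?_
    rw [hA.setLIntegral_eq]
    exact ENNReal.mul_ne_top (hA.treeAverage_ne_top hφ hφ2 _) (hA.measure_ne_top _)
  have hop : ∀ y, C.holesOp d σ φ y = ∑' t : C.SiblingPair, (C.box t.1).indicator
      (fun _ => a t) y := by
    intro y
    rw [ENNReal.tsum_sigma']
    refine tsum_congr fun R => ?_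
    by_cases hy : y ∈ C.box R
    · simp only [Set.indicator_of_mem hy, ha]
      rw [ENNReal.tsum_mul_left, C.setLIntegral_parent_sdiff, div_eq_mul_inv, mul_comm]
    · simp [Set.indicator_of_notMem hy]
  have hind : ∀ t : C.SiblingPair, Measurable ((C.box t.1).indicator fun _ => a t) :=
    fun t => measurable_const.indicator (C.measurableSet_box _)
  simp_rw [hop]
  refine lintegral_sq_tsum_le hind fun T => ?_
  -- Duality with the truncated operator itself: `∫ g²` is the bilinear form at `φ` and `g`, hence
  -- at most a constant times `‖φ‖ ‖g‖`, and `‖g‖` is absorbed.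
  set g : (Fin n → ℝ) × ℝ → ℝ≥0∞ := fun y => ∑ t ∈ T, (C.box t.1).indicator (fun _ => a t) y
    with hg
  have hgm : Measurable g := Finset.measurable_sum _ fun t _ => hind t
  have hX := lintegral_sq_sum_indicator ν (fun t : C.SiblingPair => C.measurableSet_box t.1) a T
  have hXtop := lintegral_sq_sum_indicator_ne_top
    (fun t : C.SiblingPair => C.measurableSet_box t.1) (fun t => hB.measure_ne_top t.1) ha_top T
  change ∫⁻ y, g y ^ 2 ∂ν = ∑ t ∈ T, a t * ∫⁻ y in C.box t.1, g y ∂ν at hX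
  change ∫⁻ y, g y ^ 2 ∂ν ≠ ∞ at hXtop
  have hbil := bilinear_sum_le (lev := fun R : Index n => R.1) C.fst_parent hA hB hφ hgm
    (fun t : C.SiblingPair => t.2.1) (fun t => t.1) (fun t => (C.sidePow d t.1)⁻¹) T
    (fun t _ => t.2.2.1) (D := 2 ^ n) (C.card_filter_snd_le T) (C.card_filter_fst_le T)
    (fun t _ => C.inv_sidePow_mul_le_constQ₁ d σ η t) (C.testingBound_constQ₂ d σ η T)
    (C.testingBound_constQ₃ hn d σ η hη T)
  rw [← hX, ← mul_assoc] at hbil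
  have h1 := ENNReal.sqrt_le_of_le_mul_sqrt hXtop hbil
  rw [← ENNReal.sq_sqrt (∫⁻ y, g y ^ 2 ∂ν), ← ENNReal.sq_sqrt (∫⁻ x, φ x ^ 2 ∂σ), ← mul_pow]
  refine pow_le_pow_left' (h1.trans ?_) 2
  gcongr
  have hD : (1 : ℝ≥0∞) ≤ 2 ^ n := one_le_pow₀ (by norm_num)
  push_cast
  rw [mul_add, mul_add]
  gcongr
  · norm_num
  · exact le_mul_of_one_le_right' hD
  · exact le_mul_of_one_le_right' hD

end Sufficiency

/-! ### Necessity of the testing conditions. -/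

section Necessity

/-- Test on the indicator of the hole of `R` and keep only the term of `R` in the operator. -/
theorem constQ₁_le (d : ℝ) (σ : Measure (Fin n → ℝ)) [IsLocallyFiniteMeasure σ]
    (η : Index n → ℝ≥0) {L : ℝ≥0∞}
    (hL : ∀ φ : (Fin n → ℝ) → ℝ≥0∞, Measurable φ → ∫⁻ x, φ x ^ 2 ∂σ ≠ ∞ →
      ∫⁻ y, C.holesOp d σ φ y ^ 2 ∂(C.etaMeasure η) ≤ L ^ 2 * ∫⁻ x, φ x ^ 2 ∂σ) :
    C.constQ₁ d σ η ≤ L := by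
  refine iSup_le fun R => ?_
  set E := C.cube (C.parent R) \ C.cube R with hE
  have hEm : MeasurableSet E := (C.measurableSet_cube _).diff (C.measurableSet_cube _)
  have hEtop : σ E ≠ ∞ :=
    ne_top_of_le_ne_top (C.measure_cube_ne_top σ (C.parent R)) (measure_mono Set.sdiff_subset)
  have h2 : ∫⁻ x, (E.indicator (fun _ => (1 : ℝ≥0∞)) x) ^ 2 ∂σ = σ E := by
    rw [← setLIntegral_one, ← lintegral_indicator hEm]
    refine lintegral_congr fun x => ?_
    by_cases hx : x ∈ E <;> simp [hx]
  have h := hL (E.indicator fun _ => 1) (measurable_const.indicator hEm) (by rwa [h2])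
  rw [h2] at h
  have hlow : (σ E / C.sidePow d R) ^ 2 * C.etaMeasure η (C.box R) ≤ L ^ 2 * σ E := by
    refine le_trans ?_ h
    rw [← setLIntegral_const, ← lintegral_indicator (C.measurableSet_box R)]
    refine lintegral_mono fun y => ?_
    by_cases hy : y ∈ C.box R
    · simp only [Set.indicator_of_mem hy]
      refine pow_le_pow_left' ?_ 2
      refine le_trans (le_of_eq ?_) (ENNReal.le_tsum R)
      rw [Set.indicator_of_mem hy, setLIntegral_indicator hEm, Set.inter_self, setLIntegral_one]
    · simp [Set.indicator_of_notMem hy]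
  rcases eq_or_ne (σ E) 0 with h0 | h0
  · simp [h0]
  rw [← ENNReal.sqrt_sq ((σ E * C.etaMeasure η (C.box R)) ^ (1 / 2 : ℝ) / C.sidePow d R),
    ← ENNReal.sqrt_sq L]
  refine ENNReal.sqrt_mono ?_
  rw [← ENNReal.mul_le_mul_iff_left h0 hEtop]
  refine le_trans (le_of_eq ?_) hlow
  rw [ENNReal.div_eq_inv_mul, ENNReal.div_eq_inv_mul, mul_pow, ENNReal.sq_sqrt]
  ring

/-- Test on the indicator of `R₀`, which has the full mass of every hole whose parent cube lies in
`R₀`. -/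
theorem constQ₂_le (d : ℝ) (σ : Measure (Fin n → ℝ)) [IsLocallyFiniteMeasure σ]
    (η : Index n → ℝ≥0) {L : ℝ≥0∞}
    (hL : ∀ φ : (Fin n → ℝ) → ℝ≥0∞, Measurable φ → ∫⁻ x, φ x ^ 2 ∂σ ≠ ∞ →
      ∫⁻ y, C.holesOp d σ φ y ^ 2 ∂(C.etaMeasure η) ≤ L ^ 2 * ∫⁻ x, φ x ^ 2 ∂σ) :
    C.constQ₂ d σ η ≤ L := by
  refine iSup_le fun R₀ => ENNReal.div_le_of_le_mul ?_
  have hm := C.measurableSet_cube R₀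
  have h2 : ∫⁻ x, ((C.cube R₀).indicator (fun _ => (1 : ℝ≥0∞)) x) ^ 2 ∂σ = σ (C.cube R₀) := by
    rw [← setLIntegral_one, ← lintegral_indicator hm]
    refine lintegral_congr fun x => ?_
    by_cases hx : x ∈ C.cube R₀ <;> simp [hx]
  have h := hL ((C.cube R₀).indicator fun _ => 1) (measurable_const.indicator hm)
    (by rw [h2]; exact C.measure_cube_ne_top σ R₀)
  rw [h2] at h
  rw [eLpNorm_two, ← ENNReal.sqrt_sq L, ← ENNReal.mul_sqrt]
  refine ENNReal.sqrt_mono (le_trans (lintegral_mono fun y => pow_le_pow_left' ?_ 2) h)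
  refine le_trans (ENNReal.tsum_le_tsum fun R => ?_)
    (ENNReal.tsum_comp_le_tsum_of_injective Subtype.val_injective _)
  refine Set.indicator_le_indicator ?_
  gcongr
  have hEm : MeasurableSet (C.cube (C.parent R.1) \ C.cube R.1) :=
    (C.measurableSet_cube _).diff (C.measurableSet_cube _)
  rw [setLIntegral_indicator hm, setLIntegral_one]
  exact measure_mono (Set.subset_inter (Set.sdiff_subset.trans R.2) subset_rfl)

/-- The adjoint bound: for a finite truncation `h` of the sum, `∫ h²` is at most the pairing of
`holesOp h` with the indicator of the box of `R₀`. Cauchy–Schwarz and the bound for `h` then allow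
`‖h‖` to be absorbed. -/
theorem constQ₃_le (hn : 1 ≤ n) (d : ℝ) (σ : Measure (Fin n → ℝ)) [IsLocallyFiniteMeasure σ]
    (η : Index n → ℝ≥0) (hη : ∀ a b : (Fin n → ℝ) × ℝ, C.etaMeasure η (Set.Icc a b) < ∞)
    {L : ℝ≥0∞}
    (hL : ∀ φ : (Fin n → ℝ) → ℝ≥0∞, Measurable φ → ∫⁻ x, φ x ^ 2 ∂σ ≠ ∞ →
      ∫⁻ y, C.holesOp d σ φ y ^ 2 ∂(C.etaMeasure η) ≤ L ^ 2 * ∫⁻ x, φ x ^ 2 ∂σ) :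
    C.constQ₃ d σ η ≤ L := by
  refine iSup_le fun R₀ => ENNReal.div_le_of_le_mul ?_
  set ν := C.etaMeasure η with hν
  set E : Index n → Set (Fin n → ℝ) := fun R => C.cube (C.parent R) \ C.cube R with hE
  have hEm : ∀ R, MeasurableSet (E R) :=
    fun R => (C.measurableSet_cube _).diff (C.measurableSet_cube _)
  have hEtop : ∀ R, σ (E R) ≠ ∞ := fun R =>
    ne_top_of_le_ne_top (C.measure_cube_ne_top σ (C.parent R)) (measure_mono Set.sdiff_subset)
  rw [eLpNorm_two, ← ENNReal.sqrt_sq L, ← ENNReal.mul_sqrt]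
  refine ENNReal.sqrt_mono ?_
  have hind : ∀ R : {R : Index n // C.cube (C.parent R) ⊆ C.cube R₀},
      Measurable ((E R).indicator fun _ => ν (C.box R) / C.sidePow d R) :=
    fun R => measurable_const.indicator (hEm _)
  refine lintegral_sq_tsum_le hind fun T => ?_
  set h : (Fin n → ℝ) → ℝ≥0∞ := fun x =>
    ∑ R ∈ T, (E R).indicator (fun _ => ν (C.box R) / C.sidePow d R) x with hh
  have hhm : Measurable h := Finset.measurable_sum _ fun R _ => hind R
  have hctop : ∀ R, ν (C.box R) / C.sidePow d R ≠ ∞ := fun R =>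
    ENNReal.div_ne_top (C.measure_box_ne_top hη R) (C.sidePow_ne_zero d R)
  have hX := lintegral_sq_sum_indicator σ
    (fun R : {R : Index n // C.cube (C.parent R) ⊆ C.cube R₀} => hEm R)
    (fun R => ν (C.box R) / C.sidePow d R) T
  have hXtop := lintegral_sq_sum_indicator_ne_top
    (fun R : {R : Index n // C.cube (C.parent R) ⊆ C.cube R₀} => hEm R) (fun R => hEtop R)
    (fun R => hctop R) T
  change ∫⁻ x, h x ^ 2 ∂σ = ∑ R ∈ T, ν (C.box R) / C.sidePow d R * ∫⁻ x in E R, h x ∂σ at hX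
  change ∫⁻ x, h x ^ 2 ∂σ ≠ ∞ at hXtop
  have hdual : ∫⁻ x, h x ^ 2 ∂σ ≤
      ∫⁻ y, C.holesOp d σ h y * (C.box R₀).indicator (fun _ => 1) y ∂ν := by
    calc _ = ∫⁻ y, ∑ R ∈ T, (C.box R.1).indicator
            (fun _ => (∫⁻ x in E R, h x ∂σ) / C.sidePow d R) y ∂ν := by
          rw [hX, lintegral_finsetSum _ fun R _ =>
            measurable_const.indicator (C.measurableSet_box _)]
          refine Finset.sum_congr rfl fun R _ => ?_
          rw [lintegral_indicator (C.measurableSet_box _), setLIntegral_const, div_eq_mul_inv,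
            div_eq_mul_inv]
          ring
      _ ≤ _ := by
          refine lintegral_mono fun y => ?_
          by_cases hy : y ∈ C.box R₀
          · simp only [Set.indicator_of_mem hy, mul_one]
            exact (ENNReal.sum_le_tsum _).trans (ENNReal.tsum_comp_le_tsum_of_injective
              Subtype.val_injective fun R => (C.box R).indicator
                (fun _ => (∫⁻ x in E R, h x ∂σ) / C.sidePow d R) y)
          · refine le_of_eq_of_le (Finset.sum_eq_zero fun R _ => ?_) zero_le
            exact Set.indicator_of_notMem
              (fun h' => hy (C.box_subset_of_parent_subset hn R.2 h')) _
  have h1 : ∫⁻ y, ((C.box R₀).indicator (fun _ => (1 : ℝ≥0∞)) y) ^ 2 ∂ν = ν (C.box R₀) := by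
    rw [← setLIntegral_one, ← lintegral_indicator (C.measurableSet_box R₀)]
    refine lintegral_congr fun x => ?_
    by_cases hx : x ∈ C.box R₀ <;> simp [hx]
  have h2 : ∫⁻ x, h x ^ 2 ∂σ ≤
      (L * ν (C.box R₀) ^ (1 / 2 : ℝ)) * (∫⁻ x, h x ^ 2 ∂σ) ^ (1 / 2 : ℝ) := by
    refine hdual.trans ((lintegral_mul_le_sqrt ν (C.measurable_holesOp d σ h).aemeasurable
      (measurable_const.indicator (C.measurableSet_box R₀)).aemeasurable).trans ?_)
    rw [h1]
    calc _ ≤ (L ^ 2 * ∫⁻ x, h x ^ 2 ∂σ) ^ (1 / 2 : ℝ) * ν (C.box R₀) ^ (1 / 2 : ℝ) := by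
          gcongr
          exact hL h hhm hXtop
      _ = _ := by
          rw [ENNReal.mul_sqrt, ENNReal.sqrt_sq]
          ring
  have h3 := ENNReal.sqrt_le_of_le_mul_sqrt hXtop h2
  calc ∫⁻ x, h x ^ 2 ∂σ = ((∫⁻ x, h x ^ 2 ∂σ) ^ (1 / 2 : ℝ)) ^ 2 := (ENNReal.sq_sqrt _).symm
    _ ≤ (L * ν (C.box R₀) ^ (1 / 2 : ℝ)) ^ 2 := by gcongr
    _ = _ := by rw [mul_pow, ENNReal.sq_sqrt]

end Necessity

/-! ### The two inequalities for the constants. -/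

section Equivalence

theorem holesInequality_of_testing (hn : 1 ≤ n) {d : ℝ} (hd : 0 ≤ d) (σ : Measure (Fin n → ℝ))
    [IsLocallyFiniteMeasure σ] (η : Index n → ℝ≥0)
    (hη : ∀ a b : (Fin n → ℝ) × ℝ, C.etaMeasure η (Set.Icc a b) < ∞) :
    C.HolesInequality d σ η
      (32 * 2 ^ n * (C.constQ₁ d σ η + C.constQ₂ d σ η + C.constQ₃ d σ η)) := by
  intro φ hφ
  have hae : AEMeasurable φ σ := hφ.1.aemeasurable
  -- Membership in `L²` gives only a.e. measurability; the operator does not see the change of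
  -- representative.
  set ψ := hae.mk φ with hψ
  have hψφ : φ =ᵐ[σ] ψ := hae.ae_eq_mk
  have h2 : eLpNorm φ 2 σ ^ 2 = ∫⁻ x, ψ x ^ 2 ∂σ := by
    rw [eLpNorm_congr_ae hψφ, eLpNorm_two_sq]
  have hop : ∀ y, C.holesOp d σ φ y = C.holesOp d σ ψ y := by
    intro y
    refine tsum_congr fun R => ?_
    rw [lintegral_congr_ae (ae_restrict_of_ae hψφ)]
  rw [h2]
  refine le_trans ?_ (C.lintegral_holesOp_sq_le hn d σ η hη hae.measurable_mk
    (by rw [← h2]; exact ENNReal.pow_ne_top hφ.2.ne))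
  rw [lintegral_etaMeasure]
  refine ENNReal.tsum_le_tsum fun R => ?_
  gcongr
  rw [← hop]
  exact C.poissonQ_le_holesOp hd σ φ R

theorem testing_le_of_holesInequality (hn : 1 ≤ n) (d : ℝ) (σ : Measure (Fin n → ℝ))
    [IsLocallyFiniteMeasure σ] (η : Index n → ℝ≥0)
    (hη : ∀ a b : (Fin n → ℝ) × ℝ, C.etaMeasure η (Set.Icc a b) < ∞) {K : ℝ≥0∞}
    (hK : C.HolesInequality d σ η K) :
    C.constQ₁ d σ η + C.constQ₂ d σ η + C.constQ₃ d σ η ≤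
      3 * ENNReal.ofReal (2 ^ (d + 1)) * K := by
  set e := ENNReal.ofReal (2 ^ (d + 1)) with he
  have hL : ∀ φ : (Fin n → ℝ) → ℝ≥0∞, Measurable φ → ∫⁻ x, φ x ^ 2 ∂σ ≠ ∞ →
      ∫⁻ y, C.holesOp d σ φ y ^ 2 ∂(C.etaMeasure η) ≤ (e * K) ^ 2 * ∫⁻ x, φ x ^ 2 ∂σ := by
    intro φ hφ hφ2
    have hmem : MemLp φ 2 σ := by
      refine ⟨hφ.aestronglyMeasurable, ?_⟩
      rw [eLpNorm_two]
      exact ENNReal.rpow_lt_top_of_nonneg (by norm_num) hφ2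
    have h := hK φ hmem
    rw [eLpNorm_two_sq] at h
    rw [lintegral_etaMeasure]
    calc _ ≤ ∑' R : Index n, e ^ 2 *
          (C.poissonQ d σ ((C.cube R)ᶜ.indicator φ) R ^ 2 * (η R : ℝ≥0∞)) := by
          refine ENNReal.tsum_le_tsum fun R => ?_
          rw [← mul_assoc, ← mul_pow]
          gcongr
          exact C.holesOp_le_poissonQ d σ φ R
      _ ≤ e ^ 2 * (K ^ 2 * ∫⁻ x, φ x ^ 2 ∂σ) := by
          rw [ENNReal.tsum_mul_left]
          exact mul_le_mul_right h _
      _ = _ := by ring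
  calc _ ≤ e * K + e * K + e * K :=
        add_le_add (add_le_add (C.constQ₁_le d σ η hL) (C.constQ₂_le d σ η hL))
          (C.constQ₃_le hn d σ η hη hL)
    _ = _ := by ring

end Equivalence

end DyadicGrid

end

theorem mainTheorem5 (n : ℕ) (hn : 1 ≤ n) (d : ℝ) (hd : 0 < d) :
    ∃ c : ℝ≥0, 0 < c ∧
      ∀ (C : DyadicGrid n) (σ : Measure (Fin n → ℝ)) [IsLocallyFiniteMeasure σ]
        (η : DyadicGrid.Index n → ℝ≥0),
        (∀ a b : (Fin n → ℝ) × ℝ, C.etaMeasure η (Set.Icc a b) < ∞) →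
        ((∃ K : ℝ≥0, C.HolesInequality d σ η K) ↔
            C.constQ₁ d σ η < ∞ ∧ C.constQ₂ d σ η < ∞ ∧ C.constQ₃ d σ η < ∞) ∧
          C.bestConst d σ η ≤ c * (C.constQ₁ d σ η + C.constQ₂ d σ η + C.constQ₃ d σ η) ∧
          C.constQ₁ d σ η + C.constQ₂ d σ η + C.constQ₃ d σ η ≤ c * C.bestConst d σ η := by
  -- The first summand serves sufficiency, where `2 ^ n` bounds the number of children; the second
  -- serves necessity, one `2 ^ (d + 1)` for each of the three constants.
  refine ⟨32 * 2 ^ n + 3 * Real.toNNReal (2 ^ (d + 1)), by positivity, ?_⟩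
  intro C σ _ η hη
  have hsuff := C.holesInequality_of_testing hn hd.le σ η hη
  have hnec := fun K (hK : C.HolesInequality d σ η K) =>
    C.testing_le_of_holesInequality hn d σ η hη hK
  set S := C.constQ₁ d σ η + C.constQ₂ d σ η + C.constQ₃ d σ η with hS
  have hfin : C.constQ₁ d σ η < ∞ ∧ C.constQ₂ d σ η < ∞ ∧ C.constQ₃ d σ η < ∞ ↔ S < ∞ := by
    rw [hS, ENNReal.add_lt_top, ENNReal.add_lt_top, and_assoc]
  refine ⟨?_, ?_, ?_⟩
  · rw [hfin]
    constructor
    · rintro ⟨K, hK⟩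
      exact (hnec K hK).trans_lt (ENNReal.mul_lt_top
        (ENNReal.mul_lt_top (by simp) ENNReal.ofReal_lt_top) ENNReal.coe_lt_top)
    · intro h
      have h1 : 32 * 2 ^ n * S ≠ ∞ :=
        ENNReal.mul_ne_top (ENNReal.mul_ne_top (by simp) (by simp)) h.ne
      refine ⟨(32 * 2 ^ n * S).toNNReal, ?_⟩
      rwa [ENNReal.coe_toNNReal h1]
  · refine (sInf_le hsuff).trans ?_
    gcongr
    push_cast
    exact le_self_add
  · have h3 : S ≤ 3 * ENNReal.ofReal (2 ^ (d + 1)) * C.bestConst d σ η := by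
      have hpos : (0 : ℝ) < 2 ^ (d + 1) := Real.rpow_pos_of_pos (by norm_num) _
      have h0 : 3 * ENNReal.ofReal (2 ^ (d + 1)) ≠ 0 := by simp [hpos]
      have ht : 3 * ENNReal.ofReal (2 ^ (d + 1)) ≠ ∞ :=
        ENNReal.mul_ne_top (by simp) ENNReal.ofReal_ne_top
      rw [mul_comm, ← ENNReal.div_le_iff h0 ht]
      refine le_sInf fun K hK => ?_
      rw [ENNReal.div_le_iff h0 ht, mul_comm]
      exact hnec K hK
    refine h3.trans ?_
    gcongr
    push_cast
    exact le_add_self
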